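/- Let $0<\lambda<1$ and $a>1-\lambda$. Let $g$ be the $2$-periodic sawtooth $g(x)=a\,(x-(2k-1))$ for $x\in[2k-2,2k)$, $k\in\mathbb Z$, and let $f$ be the map of the cylinder $(\mathbb R/2\mathbb Z)\times\mathbb R$ given by $\bar x=x+y+g(x)$, $\bar y=\lambda\,(y+g(x))$. Put $R=\{(x,y): |y|<\tfrac{a}{1-\lambda}\}$, $s=1+a+\lambda$, $\alpha_1=\tfrac12\big(\lambda-1-a+\sqrt{s^2-4\lambda}\big)$, $x_2=\tfrac{s-2\lambda}{\sqrt{s^2-4\lambda}}$, $y_2=\alpha_1(x_2+1)$, $M_2=(x_2,y_2)$, and let $P$ be the image on the cylinder of the closed parallelogram with vertices $(-1,0),\,M_2,\,(1,0),\,-M_2$. Then $f$ has a singular hyperbolic attractor $\mathcal A=\bigcap_{k\ge1}f^k(R)$. That is: $R$ is an open, relatively compact, trapping ($\overline{f(R)}\subset R$) and absorbing (every orbit enters $R$) domain; $\mathcal A$ is nonempty and $f(\mathcal A)=\mathcal A$; off the line $\{x=0\}$, at each point of which $f$ is discontinuous, $f$ is hyperbolic on $R$, i.e. $f$ is smooth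 there with invertible derivative and there are disjoint cones $K^u,K^s\subset\mathbb R^2$, the same at all points, with $Df\,K^u\subset K^u$, $Df^{-1}K^s\subset K^s$, such that $Df$ uniformly expands the vectors of $K^u$ and $Df^{-1}$ uniformly expands the vectors of $K^s$; and $\mathcal A$ meets the line $\{x=0\}$. Moreover $\mathcal A=\mathcal A_o\cup\mathcal A_r\cup\mathcal A_{ro}$ with three pairwise disjoint sets, each mapped by $f$ onto itself: the oscillating component $\mathcal A_o\subset P$ of the full orbits that stay in $P$, the rotating component $\mathcal A_r\subset R\setminus P$ of the full orbits that stay in $R\setminus P$, and the rotating-with-oscillations component $\mathcal A_{ro}\subset R$ of the full orbits in $R$ that visit both $P$ and $R\setminus P$; and $P\subset R$. None of them is empty. For orbits lifted to the plane: along every orbit in $\mathcal A_o$ the lifted coordinate $x$ always stays within distance $2$ of its initial value, and for some orbit in $\mathcal A_o$ the lifted $x$ is negative infinitely often and positive infinitely often; for some orbit in $\mathcal A_r$ the lifted $x$ satisfies $|x_n|\to\infty$; for some orbit in $\mathcal A_{ro}$ the lifted $x$ satisfies $|x_n|\to\infty$ and the orbit is in $P$ infinitely often and in $R\setminus P$ infinitely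 often. -/

import Mathlib

open Set Filter Topology
open scoped ContDiff

/-- The cylinder `S¹ × ℝ`, where `S¹ = ℝ / 2ℤ`. -/
abbrev Cylinder : Type := AddCircle (2 : ℝ) × ℝ

/-- The covering projection of the plane onto the cylinder. -/
def cylProj (p : ℝ × ℝ) : Cylinder := ((p.1 : AddCircle (2 : ℝ)), p.2)

/-! ### The map -/

/-- The `2`-periodic sawtooth `g(x) = a (x - (2k-1))` for `x ∈ [2k-2, 2k)`, `k ∈ ℤ`. -/
noncomputable def sawtooth (a x : ℝ) : ℝ := a * (x - (2 * (⌊x / 2⌋ : ℝ) + 1))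

theorem sawtooth_eq (a x : ℝ) (k : ℤ) (h₁ : 2 * (k : ℝ) - 2 ≤ x) (h₂ : x < 2 * (k : ℝ)) :
    sawtooth a x = a * (x - (2 * (k : ℝ) - 1)) := by
  have h : ⌊x / 2⌋ = k - 1 := by
    rw [Int.floor_eq_iff]
    push_cast
    constructor <;> linarith
  unfold sawtooth
  rw [h]
  push_cast
  ring

theorem sawtooth_periodic (a : ℝ) : Function.Periodic (sawtooth a) 2 := by
  intro x
  have h : ⌊(x + 2) / 2⌋ = ⌊x / 2⌋ + 1 := by
    rw [← Int.floor_add_one]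
    congr 1
    ring
  unfold sawtooth
  rw [h]
  push_cast
  ring

/-- The sawtooth as a function on the circle. -/
noncomputable def circleSawtooth (a : ℝ) : AddCircle (2 : ℝ) → ℝ := (sawtooth_periodic a).lift

/-- The map `x̄ = x + y + g(x)`, `ȳ = λ (y + g(x))` of the plane. -/
noncomputable def planeMap (a lam : ℝ) (p : ℝ × ℝ) : ℝ × ℝ :=
  (p.1 + p.2 + sawtooth a p.1, lam * (p.2 + sawtooth a p.1))

/-- The map `x̄ = x + y + g(x)`, `ȳ = λ (y + g(x))` of the cylinder. -/
noncomputable def cylMap (a lam : ℝ) (z : Cylinder) : Cylinder :=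
  (z.1 + ((z.2 + circleSawtooth a z.1 : ℝ) : AddCircle (2 : ℝ)),
    lam * (z.2 + circleSawtooth a z.1))

/-- The plane map is a lift of the cylinder map. -/
theorem cylProj_planeMap (a lam : ℝ) (p : ℝ × ℝ) :
    cylProj (planeMap a lam p) = cylMap a lam (cylProj p) := by
  have h : circleSawtooth a ((p.1 : ℝ) : AddCircle (2 : ℝ)) = sawtooth a p.1 :=
    (sawtooth_periodic a).lift_coe p.1
  unfold cylProj planeMap cylMap
  simp only [h]
  refine Prod.ext ?_ rfl
  simp only [← AddCircle.coe_add, add_assoc]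

/-- The discontinuity line `x = 0` of the cylinder map. -/
def discontinuityLine : Set Cylinder := {z | z.1 = 0}

/-! ### The annulus `R` and the parallelogram `P` -/

/-- The annulus `R = {(x, y) : |y| < a / (1 - λ)}`. -/
def annulusR (a lam : ℝ) : Set Cylinder := {z | |z.2| < a / (1 - lam)}

/-- The trace `s = 1 + a + λ` of the constant linear part `!![1 + a, 1; λ a, λ]`. -/
def traceS (a lam : ℝ) : ℝ := 1 + a + lam

/-- The slope `α₁` of the unstable eigenvector `(1, α₁)` of `!![1 + a, 1; λ a, λ]`. -/
noncomputable def slopeU (a lam : ℝ) : ℝ :=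
  (lam - 1 - a + Real.sqrt (traceS a lam ^ 2 - 4 * lam)) / 2

/-- The abscissa of `M₂`, the point where the unstable line through `O₁ = (-1, 0)` meets the
stable line through `O₂ = (1, 0)`. -/
noncomputable def xM₂ (a lam : ℝ) : ℝ :=
  (traceS a lam - 2 * lam) / Real.sqrt (traceS a lam ^ 2 - 4 * lam)

/-- The ordinate of `M₂`. -/
noncomputable def yM₂ (a lam : ℝ) : ℝ := slopeU a lam * (xM₂ a lam + 1)

/-- The closed parallelogram `O₁ M₂ O₂ M̄₂` in the plane, where `M̄₂ = -M₂`. -/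
noncomputable def planeP (a lam : ℝ) : Set (ℝ × ℝ) :=
  convexHull ℝ {(-1, 0), (xM₂ a lam, yM₂ a lam), (1, 0), (-xM₂ a lam, -yM₂ a lam)}

/-- The parallelogram `P` on the cylinder. -/
noncomputable def cylP (a lam : ℝ) : Set Cylinder := cylProj '' planeP a lam

/-! ### Hyperbolicity and singular hyperbolic attractors -/

/-- `f` is smooth at the point `z` of the cylinder, with linearization `L` in the coordinates
`(x, y)`: near a point `p` above `z` the map `f` has a smooth lift `F` with `DF(p) = L`. -/
def HasLinearizationAt (f : Cylinder → Cylinder) (L : (ℝ × ℝ) →L[ℝ] (ℝ × ℝ)) (z : Cylinder) :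
    Prop :=
  ∃ (p : ℝ × ℝ) (F : ℝ × ℝ → ℝ × ℝ), cylProj p = z ∧
    (∀ᶠ q in 𝓝 p, cylProj (F q) = f (cylProj q)) ∧ ContDiffAt ℝ ∞ F p ∧ HasFDerivAt F L p

/-- The Euclidean norm of a vector `(u₁, u₂)`. -/
noncomputable def euclNorm (u : ℝ × ℝ) : ℝ := Real.sqrt (u.1 ^ 2 + u.2 ^ 2)

/-- `K` is one of the two open (two-sided) cones of vectors between two distinct lines through
the origin. -/
def IsPlaneCone (K : Set (ℝ × ℝ)) : Prop :=
  ∃ v w : ℝ × ℝ, LinearIndependent ℝ ![v, w] ∧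
    K = {u | ∃ s t : ℝ, 0 < s * t ∧ u = s • v + t • w}

/-- `f` is hyperbolic on `G`: it is smooth at each point of `G`, with invertible linearization,
and there are two disjoint cones `Kᵘ`, `Kˢ`, the same at all points of `G`, such that
`Df Kᵘ ⊆ Kᵘ`, `Df⁻¹ Kˢ ⊆ Kˢ`, vectors of `Kᵘ` are uniformly expanded by `Df`, and vectors of `Kˢ`
are uniformly expanded by `Df⁻¹` (that is, `Df` contracts onto them). -/
def IsHyperbolicOn (f : Cylinder → Cylinder) (G : Set Cylinder) : Prop :=
  ∃ (Ku Ks : Set (ℝ × ℝ)) (ν : ℝ), IsPlaneCone Ku ∧ IsPlaneCone Ks ∧ Disjoint Ku Ks ∧ 1 < ν ∧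
    ∀ z ∈ G, ∃ L : (ℝ × ℝ) ≃L[ℝ] (ℝ × ℝ),
      HasLinearizationAt f (L : (ℝ × ℝ) →L[ℝ] (ℝ × ℝ)) z ∧
      (∀ u ∈ Ku, L u ∈ Ku ∧ ν * euclNorm u ≤ euclNorm (L u)) ∧
      (∀ u ∈ Ks, L.symm u ∈ Ks ∧ ν * euclNorm u ≤ euclNorm (L.symm u))

/-- `⋂_{k ≥ 1} fᵏ(G)`. -/
def attractorOf (f : Cylinder → Cylinder) (G : Set Cylinder) : Set Cylinder :=
  ⋂ k : ℕ, f^[k + 1] '' G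

/-- `A` is a singular hyperbolic attractor of `f` with trapping domain `G` and discontinuity
set `S`. -/
structure IsSingularHyperbolicAttractor (f : Cylinder → Cylinder) (S G A : Set Cylinder) :
    Prop where
  isOpen_domain : IsOpen G
  isCompact_closure : IsCompact (closure G)
  /-- `G` is a trapping domain: `f(G) ⊆ G`, even with the closure of `f(G)`. -/
  trapping : closure (f '' G) ⊆ G
  /-- `G` is absorbing: each orbit enters it (and then stays there). -/
  absorbing : ∀ z, ∃ n : ℕ, f^[n] z ∈ G
  /-- `A` is the attractor of the trapping domain. -/
  eq_attractorOf : A = attractorOf f G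
  nonempty : A.Nonempty
  invariant : f '' A = A
  /-- `f` is hyperbolic off the discontinuity set. -/
  hyperbolic : IsHyperbolicOn f (G \ S)
  /-- `f` is discontinuous at each point of `S`. -/
  discontinuous : ∀ z ∈ S, ¬ ContinuousAt f z
  /-- The attractor is singular: it meets the discontinuity set. -/
  singular : (A ∩ S).Nonempty

/-! ### The three components -/

/-- `o` is a full (two-sided) orbit of `f`. -/
def IsFullOrbit (f : Cylinder → Cylinder) (o : ℤ → Cylinder) : Prop := ∀ n, o (n + 1) = f (o n)

/-- The oscillating component `A_o`: the points of full orbits that stay in `P`. -/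
def oscillatingPart (a lam : ℝ) : Set Cylinder :=
  {z | ∃ o, IsFullOrbit (cylMap a lam) o ∧ o 0 = z ∧ ∀ n, o n ∈ cylP a lam}

/-- The rotating component `A_r`: the points of full orbits that stay in `R ∖ P`. -/
def rotatingPart (a lam : ℝ) : Set Cylinder :=
  {z | ∃ o, IsFullOrbit (cylMap a lam) o ∧ o 0 = z ∧ ∀ n, o n ∈ annulusR a lam \ cylP a lam}

/-- The rotating-with-oscillations component `A_ro`: the points of full orbits in `R` that pass
both through `P` and through `R ∖ P`. -/
def rotatingOscillatingPart (a lam : ℝ) : Set Cylinder :=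
  {z | ∃ o, IsFullOrbit (cylMap a lam) o ∧ o 0 = z ∧ (∀ n, o n ∈ annulusR a lam) ∧
    (∃ m, o m ∈ cylP a lam) ∧ (∃ n, o n ∈ annulusR a lam \ cylP a lam)}

/-- The abscissa, on the universal cover, of the `n`-th point of the orbit of `p`. -/
noncomputable def liftX (a lam : ℝ) (p : ℝ × ℝ) (n : ℕ) : ℝ := ((planeMap a lam)^[n] p).1

/-! On each strip of the covering plane, centred at `(2k - 1, 0)`, the map is linear about the
centre with the same matrix, of determinant `λ` and eigenvalues `μ > 1 > ν > 0`. In eigencoordinates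
`(ξ, η)` it is `(μξ, νη)` while `-1 ≤ ξ + η < 1`. The period `(2, 0)` has eigencoordinates `(A, B) =
(1 + xM₂, 1 - xM₂)`, so passing to a neighbouring strip translates by `(A, B)`, and the lifts of `P`
are the boxes `[jA, (j+1)A] × [jB, (j+1)B]`, joined corner to corner along a diagonal.

The attractor part is soft: contraction in `y` beats the bounded sawtooth, the coordinate quadrants
are invariant cones, and the unstable segment of the fixed point runs from `P` to the discontinuity
line. The map is a bijection, so every point has exactly one full orbit, and sorting these orbits by
their visits to `P` gives the invariant decomposition (`attractorOf_eq_union`).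

Orbits in `A_o` do not wind because `P` can only return to its own lift (`planeMap_mem_same_lift`).
The required orbits are periodic. For `A_o` it is a 2-cycle symmetric about the centre of `P`. For
the other two, `exists_block_length` codes passages of fixed length through strips by exit signs `ε
= ±1`; a periodic sign sequence determines `ξ` from future exits and `η` from past exits by
geometric series. The sequence `+` gives a rotating orbit outside `P`, and `+, -, +` one that also
meets `P`. The coding needs the unstable line to reach beyond `M₂`, that is `A < μ`, which is where
`1 - λ < a` is used. -/

/-! ### Eigenvalues and eigenvectors of the linear part -/

/-- The unstable eigenvalue of `!![1 + a, 1; λ a, λ]`. -/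
noncomputable def eigU (a lam : ℝ) : ℝ :=
  (traceS a lam + Real.sqrt (traceS a lam ^ 2 - 4 * lam)) / 2

/-- The stable eigenvalue of `!![1 + a, 1; λ a, λ]`. -/
noncomputable def eigS (a lam : ℝ) : ℝ :=
  (traceS a lam - Real.sqrt (traceS a lam ^ 2 - 4 * lam)) / 2

/-- The slope of the stable eigenvector of `!![1 + a, 1; λ a, λ]`. -/
noncomputable def slopeS (a lam : ℝ) : ℝ :=
  (lam - 1 - a - Real.sqrt (traceS a lam ^ 2 - 4 * lam)) / 2

/-- The standing assumptions on the parameters. -/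
structure Params (a lam : ℝ) : Prop where
  lam_pos : 0 < lam
  lam_lt : lam < 1
  lt_a : 1 - lam < a

namespace Params

variable {a lam : ℝ} (h : Params a lam)
include h

theorem a_pos : 0 < a := by linarith [h.lam_lt, h.lt_a]

theorem disc_pos : 0 < traceS a lam ^ 2 - 4 * lam := by
  have h1 := h.lam_lt
  have h2 := h.lt_a
  unfold traceS
  nlinarith

theorem sqrt_pos : 0 < Real.sqrt (traceS a lam ^ 2 - 4 * lam) := Real.sqrt_pos.2 h.disc_pos

theorem sq_sqrt : Real.sqrt (traceS a lam ^ 2 - 4 * lam) ^ 2 = (1 + a - lam) ^ 2 + 4 * lam * a := by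
  rw [Real.sq_sqrt h.disc_pos.le]
  unfold traceS
  ring

theorem lt_sqrt : 1 + a - lam < Real.sqrt (traceS a lam ^ 2 - 4 * lam) := by
  have h1 := h.sq_sqrt
  have h2 := h.sqrt_pos
  have h3 := mul_pos h.lam_pos h.a_pos
  nlinarith

theorem sqrt_lt : Real.sqrt (traceS a lam ^ 2 - 4 * lam) < 1 + a + lam := by
  have h1 := h.sq_sqrt
  have h2 := h.sqrt_pos
  have h3 := h.lam_pos
  have h4 := h.a_pos
  nlinarith

theorem one_lt_eigU : 1 < eigU a lam := by
  have h1 := h.lt_sqrt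
  unfold eigU traceS at *
  linarith [h.lt_a, h.lam_lt]

theorem eigS_pos : 0 < eigS a lam := by
  have h1 := h.sqrt_lt
  unfold eigS traceS at *
  linarith

theorem eigS_lt_one : eigS a lam < 1 := by
  have h1 := h.lt_sqrt
  unfold eigS traceS at *
  linarith [h.lam_lt]

theorem slopeU_pos : 0 < slopeU a lam := by
  have h1 := h.lt_sqrt
  unfold slopeU
  linarith

theorem slopeS_neg : slopeS a lam < 0 := by
  have h1 := h.sqrt_pos
  unfold slopeS
  linarith [h.a_pos, h.lam_lt]

omit h in
theorem eigU_eq : eigU a lam = 1 + a + slopeU a lam := by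
  unfold eigU slopeU traceS
  ring

omit h in
theorem eigS_eq : eigS a lam = 1 + a + slopeS a lam := by
  unfold eigS slopeS traceS
  ring

/-- Together with `eigU_eq`, this is the eigenvector equation for `(1, slopeU)`. -/
theorem slopeU_eq : lam * (a + slopeU a lam) = eigU a lam * slopeU a lam := by
  have h1 := h.sq_sqrt
  unfold eigU slopeU
  set d := Real.sqrt (traceS a lam ^ 2 - 4 * lam)
  unfold traceS
  linear_combination (-1 / 4) * h1

theorem slopeS_eq : lam * (a + slopeS a lam) = eigS a lam * slopeS a lam := by
  have h1 := h.sq_sqrt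
  unfold eigS slopeS
  set d := Real.sqrt (traceS a lam ^ 2 - 4 * lam)
  unfold traceS
  linear_combination (-1 / 4) * h1

theorem xM₂_mul_sqrt :
    xM₂ a lam * Real.sqrt (traceS a lam ^ 2 - 4 * lam) = 1 + a - lam := by
  unfold xM₂
  rw [div_mul_cancel₀ _ h.sqrt_pos.ne']
  unfold traceS
  ring

theorem xM₂_pos : 0 < xM₂ a lam := by
  refine div_pos ?_ h.sqrt_pos
  unfold traceS
  linarith [h.lam_lt, h.a_pos]

theorem xM₂_lt_one : xM₂ a lam < 1 := by
  have h1 := h.lt_sqrt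
  rw [← h.xM₂_mul_sqrt] at h1
  have h2 := h.sqrt_pos
  by_contra! h3
  nlinarith

/-- The unstable line of `O₁`, continued up to the discontinuity line, is mapped beyond `M₂`:
this is where `1 - λ < a` enters. -/
theorem one_add_xM₂_lt : 1 + xM₂ a lam < eigU a lam := by
  have h1 := h.xM₂_mul_sqrt
  have h2 := h.sq_sqrt
  have h3 := h.sqrt_pos
  unfold eigU
  set d := Real.sqrt (traceS a lam ^ 2 - 4 * lam)
  unfold traceS
  have h4 := h.lt_a
  -- The two sides differ by exactly `(a + lam - 1) * eigU a lam`.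
  have h5 : xM₂ a lam * d < ((1 + a + lam + d) / 2 - 1) * d := by
    have : 0 < (a + lam - 1) * d := mul_pos (by linarith) h3
    nlinarith [h.lam_lt, h.lam_pos]
  linarith [lt_of_mul_lt_mul_right h5 h3.le]

/-- The vector with eigencoordinates `(1 + xM₂, 1 - xM₂)` is horizontal, hence equal to the period
`(2, 0)`. -/
theorem slope_balance :
    slopeU a lam * (1 + xM₂ a lam) + slopeS a lam * (1 - xM₂ a lam) = 0 := by
  have h1 := h.xM₂_mul_sqrt
  unfold slopeU slopeS
  linear_combination h1

theorem yM₂_pos : 0 < yM₂ a lam :=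
  mul_pos h.slopeU_pos (by linarith [h.xM₂_pos])

theorem yM₂_lt : yM₂ a lam < a / (1 - lam) := by
  have h0 : 0 < 1 - lam := by linarith [h.lam_lt]
  have h1 : yM₂ a lam ≤ 2 * slopeU a lam := by
    unfold yM₂
    nlinarith [h.slopeU_pos, h.xM₂_lt_one]
  have h2 : 1 < a / (1 - lam) := by
    rw [lt_div_iff₀ h0]
    linarith [h.lt_a]
  have h3 : a < a / (1 - lam) := by
    rw [lt_div_iff₀ h0]
    nlinarith [h.a_pos, h.lam_pos]
  have h4 := h.sq_sqrt
  have h5 := h.sqrt_pos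
  refine h1.trans_lt ?_
  unfold slopeU
  set d := Real.sqrt (traceS a lam ^ 2 - 4 * lam)
  set t := a / (1 - lam)
  have h6 : a = t * (1 - lam) := by
    simp only [t]
    field_simp
  -- After squaring, since `t * (1 - lam) = a`, this is `4λa < t² + 2a + 2at`, true because `t > 1 >
  -- λ`.
  suffices d < t + (1 + a - lam) by linarith
  have h7 := h.lam_lt
  have h8 := h.a_pos
  have h9 : lam * a < t := by nlinarith
  have h10 : a * t ≥ a := by nlinarith
  have h11 : lam * a < a := by nlinarith
  have h12 : t * (1 + a - lam) = a + a * t := by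
    nlinarith
  have h13 : d ^ 2 < (t + (1 + a - lam)) ^ 2 := by nlinarith
  exact lt_of_pow_lt_pow_left₀ 2 (by linarith) h13

end Params

/-! ### Eigencoordinates -/

/-- The point with coordinates `(ξ, η)` in the eigenframe centred at `(c, 0)`. -/
noncomputable def eigenPt (a lam c ξ η : ℝ) : ℝ × ℝ :=
  (c + ξ + η, slopeU a lam * ξ + slopeS a lam * η)

section EigenPt

variable {a lam : ℝ}

theorem eigenPt_shift (h : Params a lam) (c ξ η j : ℝ) :
    eigenPt a lam (c + 2 * j) ξ η =
      eigenPt a lam c (ξ + j * (1 + xM₂ a lam)) (η + j * (1 - xM₂ a lam)) := by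
  refine Prod.ext ?_ ?_
  · simp only [eigenPt]
    ring
  · simp only [eigenPt]
    linear_combination (-j) * h.slope_balance

theorem eigenPt_inj (h : Params a lam) {c ξ η ξ' η' : ℝ}
    (he : eigenPt a lam c ξ η = eigenPt a lam c ξ' η') : ξ = ξ' ∧ η = η' := by
  have h1 : c + ξ + η = c + ξ' + η' := congrArg Prod.fst he
  have h2 : slopeU a lam * ξ + slopeS a lam * η = slopeU a lam * ξ' + slopeS a lam * η' :=
    congrArg Prod.snd he
  have h3 : (slopeU a lam - slopeS a lam) * (ξ - ξ') = 0 := by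
    linear_combination h2 - slopeS a lam * h1
  have h4 : slopeU a lam - slopeS a lam ≠ 0 := by linarith [h.slopeU_pos, h.slopeS_neg]
  have h5 : ξ - ξ' = 0 := (mul_eq_zero.1 h3).resolve_left h4
  constructor <;> linarith

/-- The bounds on `ξ + η` describe the half-open strip on which the sawtooth is a single line, so
the eigenvector equations apply. -/
theorem planeMap_eigenPt (h : Params a lam) (k : ℤ) {ξ η : ℝ} (h₁ : -1 ≤ ξ + η)
    (h₂ : ξ + η < 1) :
    planeMap a lam (eigenPt a lam (2 * k - 1) ξ η) =
      eigenPt a lam (2 * k - 1) (eigU a lam * ξ) (eigS a lam * η) := by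
  have hs : sawtooth a (2 * k - 1 + ξ + η) = a * (ξ + η) := by
    rw [sawtooth_eq a _ k (by linarith) (by linarith)]
    ring
  refine Prod.ext ?_ ?_
  · simp only [planeMap, eigenPt, hs]
    rw [Params.eigU_eq, Params.eigS_eq]
    ring
  · simp only [planeMap, eigenPt, hs]
    linear_combination ξ * h.slopeU_eq + η * h.slopeS_eq

/-! ### Orbit segments inside one strip -/

theorem pow_mul_add_le_succ {μ ν b c : ℝ} (hμ : 0 < μ) (hν : 0 < ν) (hb : 0 ≤ b) (hc : 0 ≤ c)
    (N : ℕ) :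
    μ ^ N * b + ν ^ N * c ≤ max (b + c) (μ ^ (N + 1) * b + ν ^ (N + 1) * c) := by
  induction N with
  | zero => simp
  | succ N ih =>
    rw [le_max_iff] at ih ⊢
    have convex : 2 * (μ ^ (N + 1) * b + ν ^ (N + 1) * c) ≤
        μ ^ N * b + ν ^ N * c + (μ ^ (N + 2) * b + ν ^ (N + 2) * c) := by
      have h1 : 0 ≤ μ ^ N * b * (μ - 1) ^ 2 := by positivity
      have h2 : 0 ≤ ν ^ N * c * (ν - 1) ^ 2 := by positivity
      linear_combination h1 + h2
    by_contra! hlt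
    rcases ih with ih | ih <;> linarith [hlt.1, hlt.2]

/-- A nonnegative combination of exponentials is convex in the exponent, so its maximum over `0, …,
N` is at an endpoint. -/
theorem pow_mul_add_le {μ ν b c : ℝ} (hμ : 0 < μ) (hν : 0 < ν) (hb : 0 ≤ b) (hc : 0 ≤ c)
    {N j : ℕ} (hj : j ≤ N) :
    μ ^ j * b + ν ^ j * c ≤ max (b + c) (μ ^ N * b + ν ^ N * c) := by
  induction N, hj using Nat.le_induction with
  | base => exact le_max_right _ _
  | succ N _ ih =>
    exact ih.trans (max_le (le_max_left _ _) (pow_mul_add_le_succ hμ hν hb hc N))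

/-- An orbit segment that stays in one strip of linearity, with exit at its end. -/
theorem planeMap_iterate_eigenPt (h : Params a lam) (k : ℤ) {ξ η : ℝ} {N : ℕ}
    (h₁ : |ξ| + |η| < 1) (h₂ : eigU a lam ^ N * |ξ| + eigS a lam ^ N * |η| < 1) {j : ℕ}
    (hj : j ≤ N + 1) :
    (planeMap a lam)^[j] (eigenPt a lam (2 * k - 1) ξ η) =
      eigenPt a lam (2 * k - 1) (eigU a lam ^ j * ξ) (eigS a lam ^ j * η) := by
  have hμ : 0 < eigU a lam := by linarith [h.one_lt_eigU]
  have hν := h.eigS_pos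
  induction j with
  | zero => simp
  | succ j ih =>
    -- By convexity the two endpoint conditions keep times `0, …, N` in the strip; the point at time
    -- `N + 1` may lie outside it.
    have hle := pow_mul_add_le hμ hν (abs_nonneg ξ) (abs_nonneg η) (show j ≤ N by omega)
    have hlt := hle.trans_lt (max_lt h₁ h₂)
    have habs : |eigU a lam ^ j * ξ + eigS a lam ^ j * η| < 1 := by
      refine (abs_add_le _ _).trans_lt ?_
      rwa [abs_mul, abs_mul, abs_of_pos (pow_pos hμ j), abs_of_pos (pow_pos hν j)]
    rw [abs_lt] at habs
    rw [Function.iterate_succ_apply', ih (by omega), planeMap_eigenPt h k habs.1.le habs.2]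
    congr 1 <;> ring

/-! ### The parallelogram in eigencoordinates -/

theorem cylProj_eq_iff {p q : ℝ × ℝ} :
    cylProj p = cylProj q ↔ ∃ m : ℤ, p = q + (2 * (m : ℝ), 0) := by
  constructor
  · intro he
    obtain ⟨h1, h2⟩ := Prod.ext_iff.1 he
    simp only [cylProj] at h1 h2
    rw [← sub_eq_zero, ← AddCircle.coe_sub, AddCircle.coe_eq_zero_iff] at h1
    obtain ⟨m, hm⟩ := h1
    refine ⟨m, Prod.ext ?_ ?_⟩
    · simp only [Prod.fst_add]
      rw [zsmul_eq_mul] at hm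
      linarith
    · simpa using h2
  · rintro ⟨m, rfl⟩
    have h0 : ((2 * (m : ℝ) : ℝ) : AddCircle (2 : ℝ)) = 0 :=
      (AddCircle.coe_eq_zero_iff _).2 ⟨m, by rw [zsmul_eq_mul, mul_comm]⟩
    refine Prod.ext ?_ ?_
    · simp only [cylProj, Prod.fst_add, AddCircle.coe_add, h0, add_zero]
    · simp [cylProj]

/-- The coordinates, with respect to the eigenframe at `(2 k - 1, 0)`, of the points above `P`. -/
theorem mem_planeP_iff (h : Params a lam) {p : ℝ × ℝ} :
    p ∈ planeP a lam ↔ ∃ ξ η : ℝ, 0 ≤ ξ ∧ ξ ≤ 1 + xM₂ a lam ∧ 0 ≤ η ∧ η ≤ 1 - xM₂ a lam ∧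
      p = eigenPt a lam (-1) ξ η := by
  have hX₀ := h.xM₂_pos
  have hX₁ := h.xM₂_lt_one
  have hbal := h.slope_balance
  have hO₁ : ((-1, 0) : ℝ × ℝ) = eigenPt a lam (-1) 0 0 := by simp [eigenPt]
  have hM₂ : (xM₂ a lam, yM₂ a lam) = eigenPt a lam (-1) (1 + xM₂ a lam) 0 := by
    ext <;> simp [eigenPt, yM₂, add_comm]
  have hO₂ : ((1, 0) : ℝ × ℝ) = eigenPt a lam (-1) (1 + xM₂ a lam) (1 - xM₂ a lam) := by
    refine Prod.ext ?_ ?_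
    · simp only [eigenPt]
      ring
    · exact hbal.symm
  have hM : (-xM₂ a lam, -yM₂ a lam) = eigenPt a lam (-1) 0 (1 - xM₂ a lam) := by
    refine Prod.ext ?_ ?_
    · simp only [eigenPt]
      ring
    · simp only [eigenPt, yM₂]
      linear_combination -hbal
  have hcomb : ∀ s t ξ η ξ' η' : ℝ, s + t = 1 →
      s • eigenPt a lam (-1) ξ η + t • eigenPt a lam (-1) ξ' η' =
        eigenPt a lam (-1) (s * ξ + t * ξ') (s * η + t * η') := by
    intro s t ξ η ξ' η' hst
    refine Prod.ext ?_ ?_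
    · simp only [eigenPt, Prod.smul_mk, Prod.mk_add_mk, smul_eq_mul]
      linear_combination -hst
    · simp only [eigenPt, Prod.smul_mk, Prod.mk_add_mk, smul_eq_mul]
      ring
  unfold planeP
  rw [hO₁, hM₂, hO₂, hM]
  constructor
  · intro hp
    have hsub := convexHull_min (𝕜 := ℝ) (s := {eigenPt a lam (-1) 0 0, eigenPt a lam (-1) (1 + xM₂ a lam) 0,
      eigenPt a lam (-1) (1 + xM₂ a lam) (1 - xM₂ a lam),
      eigenPt a lam (-1) 0 (1 - xM₂ a lam)}) (t := {p | ∃ ξ η : ℝ, 0 ≤ ξ ∧ ξ ≤ 1 + xM₂ a lam ∧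
        0 ≤ η ∧ η ≤ 1 - xM₂ a lam ∧ p = eigenPt a lam (-1) ξ η}) ?_ ?_
    · exact hsub hp
    · rintro q (rfl | rfl | rfl | rfl)
      · exact ⟨0, 0, le_rfl, by linarith, le_rfl, by linarith, rfl⟩
      · exact ⟨_, 0, by linarith, le_rfl, le_rfl, by linarith, rfl⟩
      · exact ⟨_, _, by linarith, le_rfl, by linarith, le_rfl, rfl⟩
      · exact ⟨0, _, le_rfl, by linarith, by linarith, le_rfl, rfl⟩
    · rintro _ ⟨ξ, η, b1, b2, b3, b4, rfl⟩ _ ⟨ξ', η', c1, c2, c3, c4, rfl⟩ s t hs ht hst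
      refine ⟨s * ξ + t * ξ', s * η + t * η', by positivity, ?_, by positivity, ?_,
        hcomb _ _ _ _ _ _ hst⟩
      · calc s * ξ + t * ξ' ≤ s * (1 + xM₂ a lam) + t * (1 + xM₂ a lam) := by gcongr
          _ = 1 + xM₂ a lam := by rw [← add_mul, hst, one_mul]
      · calc s * η + t * η' ≤ s * (1 - xM₂ a lam) + t * (1 - xM₂ a lam) := by gcongr
          _ = 1 - xM₂ a lam := by rw [← add_mul, hst, one_mul]
  · rintro ⟨ξ, η, b1, b2, b3, b4, rfl⟩
    set A := 1 + xM₂ a lam with hA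
    set B := 1 - xM₂ a lam with hB
    have hA0 : 0 < A := by linarith
    have hB0 : 0 < B := by linarith
    have hC := convex_convexHull ℝ ({eigenPt a lam (-1) 0 0, eigenPt a lam (-1) A 0,
      eigenPt a lam (-1) A B, eigenPt a lam (-1) 0 B} : Set (ℝ × ℝ))
    have hv := subset_convexHull ℝ ({eigenPt a lam (-1) 0 0, eigenPt a lam (-1) A 0,
      eigenPt a lam (-1) A B, eigenPt a lam (-1) 0 B} : Set (ℝ × ℝ))
    have hs0 : 0 ≤ ξ / A := by positivity
    have hs1 : 0 ≤ 1 - ξ / A := by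
      rw [sub_nonneg, div_le_one hA0]
      exact b2
    have ht0 : 0 ≤ η / B := by positivity
    have ht1 : 0 ≤ 1 - η / B := by
      rw [sub_nonneg, div_le_one hB0]
      exact b4
    -- Points of the sides `η = 0` and `η = B` at the fraction `ξ / A`, then joined at the fraction
    -- `η / B`.
    have e1 := hC (hv (show eigenPt a lam (-1) 0 0 ∈ _ by simp))
      (hv (show eigenPt a lam (-1) A 0 ∈ _ by simp)) hs1 hs0 (by ring)
    have e2 := hC (hv (show eigenPt a lam (-1) 0 B ∈ _ by simp))
      (hv (show eigenPt a lam (-1) A B ∈ _ by simp)) hs1 hs0 (by ring)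
    have e3 := hC e1 e2 ht1 ht0 (by ring)
    rw [hcomb _ _ _ _ _ _ (by ring), hcomb _ _ _ _ _ _ (by ring),
      hcomb _ _ _ _ _ _ (by ring)] at e3
    convert e3 using 2
    · field_simp
      ring
    · field_simp
      ring

/-- Membership in `P` of a point of the cylinder in eigencoordinates. -/
theorem cylProj_mem_cylP_iff (h : Params a lam) {p : ℝ × ℝ} :
    cylProj p ∈ cylP a lam ↔ ∃ (k : ℤ) (ξ η : ℝ), 0 ≤ ξ ∧ ξ ≤ 1 + xM₂ a lam ∧ 0 ≤ η ∧
      η ≤ 1 - xM₂ a lam ∧ p = eigenPt a lam (2 * k - 1) ξ η := by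
  have hshift : ∀ (k : ℤ) (ξ η : ℝ),
      eigenPt a lam (-1) ξ η + (2 * (k : ℝ), 0) = eigenPt a lam (2 * k - 1) ξ η := by
    intro k ξ η
    refine Prod.ext ?_ ?_ <;> simp only [eigenPt, Prod.mk_add_mk] <;> ring
  constructor
  · rintro ⟨q, hq, he⟩
    obtain ⟨ξ, η, b1, b2, b3, b4, rfl⟩ := (mem_planeP_iff h).1 hq
    obtain ⟨m, hm⟩ := cylProj_eq_iff.1 he.symm
    exact ⟨m, ξ, η, b1, b2, b3, b4, by rw [hm, hshift]⟩
  · rintro ⟨k, ξ, η, b1, b2, b3, b4, rfl⟩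
    refine ⟨eigenPt a lam (-1) ξ η, (mem_planeP_iff h).2 ⟨ξ, η, b1, b2, b3, b4, rfl⟩, ?_⟩
    exact (cylProj_eq_iff.2 ⟨k, (hshift k ξ η).symm⟩).symm

theorem eigenPt_mem_cylP_of_nonneg (h : Params a lam) (k : ℤ) {ξ η : ℝ} (b1 : 0 ≤ ξ)
    (b2 : ξ ≤ 1 + xM₂ a lam) (b3 : 0 ≤ η) (b4 : η ≤ 1 - xM₂ a lam) :
    cylProj (eigenPt a lam (2 * k - 1) ξ η) ∈ cylP a lam :=
  (cylProj_mem_cylP_iff h).2 ⟨k, ξ, η, b1, b2, b3, b4, rfl⟩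

theorem eigenPt_int_shift (h : Params a lam) (k m : ℤ) (ξ η : ℝ) :
    eigenPt a lam (2 * m - 1) ξ η = eigenPt a lam (2 * k - 1)
      (ξ + ((m - k : ℤ) : ℝ) * (1 + xM₂ a lam)) (η + ((m - k : ℤ) : ℝ) * (1 - xM₂ a lam)) := by
  rw [← eigenPt_shift h]
  congr 1
  push_cast
  ring

/-- Points above the unstable line and below the stable line of the centre of the strip lie
outside `P`. -/
theorem eigenPt_notMem_cylP (h : Params a lam) (k : ℤ) {ξ η : ℝ} (hξ : 0 < ξ) (hη : η < 0) :
    cylProj (eigenPt a lam (2 * k - 1) ξ η) ∉ cylP a lam := by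
  intro hmem
  obtain ⟨m, ξ', η', b1, b2, b3, b4, he⟩ := (cylProj_mem_cylP_iff h).1 hmem
  rw [eigenPt_int_shift h k m] at he
  obtain ⟨e1, e2⟩ := eigenPt_inj h he
  have hX₀ := h.xM₂_pos
  have hX₁ := h.xM₂_lt_one
  -- Seen from strip `k`, a lift of `P` lies in the closed third quadrant if `m < k` and in the
  -- closed first quadrant if `m ≥ k`, never in the open fourth one.
  rcases lt_or_ge (m - k) 0 with hj | hj
  · have : ((m - k : ℤ) : ℝ) ≤ -1 := by exact_mod_cast Int.le_sub_one_of_lt hj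
    nlinarith
  · have : (0 : ℝ) ≤ ((m - k : ℤ) : ℝ) := by exact_mod_cast hj
    nlinarith

/-- If a point of a lift of `P` is mapped into some lift of `P`, it is mapped into the same
lift. -/
theorem planeMap_mem_same_lift (h : Params a lam) (k : ℤ) {ξ η : ℝ} (b1 : 0 ≤ ξ)
    (b2 : ξ ≤ 1 + xM₂ a lam) (b3 : 0 ≤ η) (b4 : η ≤ 1 - xM₂ a lam)
    (hmem : cylProj (planeMap a lam (eigenPt a lam (2 * k - 1) ξ η)) ∈ cylP a lam) :
    ∃ ξ' η' : ℝ, 0 ≤ ξ' ∧ ξ' ≤ 1 + xM₂ a lam ∧ 0 ≤ η' ∧ η' ≤ 1 - xM₂ a lam ∧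
      planeMap a lam (eigenPt a lam (2 * k - 1) ξ η) = eigenPt a lam (2 * k - 1) ξ' η' := by
  obtain ⟨m, ξ', η', c1, c2, c3, c4, he⟩ := (cylProj_mem_cylP_iff h).1 hmem
  have hX₀ := h.xM₂_pos
  have hX₁ := h.xM₂_lt_one
  have hμ := h.one_lt_eigU
  have hν₀ := h.eigS_pos
  have hν₁ := h.eigS_lt_one
  rcases lt_or_ge (ξ + η) 1 with hlt | hge
  -- Left half of the box: the image has nonnegative coordinates and `η < B`. This excludes the
  -- lifts to the right, and a lift to the left shares only the corner `(0, 0)`.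
  · rw [planeMap_eigenPt h k (by linarith) hlt] at he ⊢
    have he' := he
    rw [eigenPt_int_shift h k m] at he'
    obtain ⟨e1, e2⟩ := eigenPt_inj h he'
    have hU : 0 ≤ eigU a lam * ξ := by positivity
    have hS : 0 ≤ eigS a lam * η := by positivity
    have hS' : eigS a lam * η < 1 - xM₂ a lam := by nlinarith
    rcases lt_trichotomy (m - k) 0 with hj | hj | hj
    · have : ((m - k : ℤ) : ℝ) ≤ -1 := by exact_mod_cast Int.le_sub_one_of_lt hj
      refine ⟨_, _, hU, ?_, hS, hS'.le, rfl⟩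
      nlinarith
    · obtain rfl : m = k := by omega
      exact ⟨ξ', η', c1, c2, c3, c4, he⟩
    · have : (1 : ℝ) ≤ ((m - k : ℤ) : ℝ) := by exact_mod_cast hj
      nlinarith
  -- The right half lies in strip `k + 1`; the argument is the previous one reflected in the centre
  -- of the box.
  · have hs := eigenPt_int_shift h (k + 1) k ξ η
    have hk : k - (k + 1) = -1 := by ring
    rw [hk] at hs
    rw [hs, planeMap_eigenPt h (k + 1) (by push_cast; linarith) (by push_cast; linarith)] at he ⊢
    have hback := eigenPt_int_shift h k (k + 1) (eigU a lam * (ξ + -1 * (1 + xM₂ a lam)))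
      (eigS a lam * (η + -1 * (1 - xM₂ a lam)))
    have hk' : k + 1 - k = 1 := by ring
    rw [hk', Int.cast_one] at hback
    simp only [Int.cast_neg, Int.cast_one] at he ⊢
    rw [hback] at he ⊢
    have he' := he
    rw [eigenPt_int_shift h k m] at he'
    obtain ⟨e1, e2⟩ := eigenPt_inj h he'
    have hU : 0 ≤ eigU a lam * (1 + xM₂ a lam - ξ) := mul_nonneg (by linarith) (by linarith)
    have hS : 0 ≤ eigS a lam * (1 - xM₂ a lam - η) := mul_nonneg hν₀.le (by linarith)
    have hS' : eigS a lam * (1 - xM₂ a lam - η) < 1 - xM₂ a lam := by nlinarith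
    rcases lt_trichotomy (m - k) 0 with hj | hj | hj
    · have : ((m - k : ℤ) : ℝ) ≤ -1 := by exact_mod_cast Int.le_sub_one_of_lt hj
      nlinarith
    · obtain rfl : m = k := by omega
      exact ⟨ξ', η', c1, c2, c3, c4, he⟩
    · have : (1 : ℝ) ≤ ((m - k : ℤ) : ℝ) := by exact_mod_cast hj
      refine ⟨_, _, ?_, ?_, ?_, ?_, rfl⟩ <;> nlinarith

end EigenPt

/-! ### The map of the cylinder -/

theorem cylProj_surjective : Function.Surjective cylProj := by
  rintro ⟨x, y⟩
  obtain ⟨x, rfl⟩ := QuotientAddGroup.mk_surjective x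
  exact ⟨(x, y), rfl⟩

theorem continuous_cylProj : Continuous cylProj :=
  ((AddCircle.continuous_mk' (2 : ℝ)).comp continuous_fst).prodMk continuous_snd

theorem cylProj_planeMap_iterate (a lam : ℝ) (n : ℕ) (p : ℝ × ℝ) :
    cylProj ((planeMap a lam)^[n] p) = (cylMap a lam)^[n] (cylProj p) := by
  induction n with
  | zero => rfl
  | succ n ih => rw [Function.iterate_succ_apply', Function.iterate_succ_apply',
      cylProj_planeMap, ih]

/-- The cylinder map is bijective. -/
noncomputable def cylPerm (a : ℝ) {lam : ℝ} (hl : lam ≠ 0) : Equiv.Perm Cylinder where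
  toFun := cylMap a lam
  -- Since `ȳ / λ = y + g(x)`, the image determines first `x = x̄ - ȳ / λ` and then `y`.
  invFun z := (z.1 - ((z.2 / lam : ℝ) : AddCircle (2 : ℝ)),
    z.2 / lam - circleSawtooth a (z.1 - ((z.2 / lam : ℝ) : AddCircle (2 : ℝ))))
  left_inv z := by
    have h : lam * (z.2 + circleSawtooth a z.1) / lam = z.2 + circleSawtooth a z.1 :=
      mul_div_cancel_left₀ _ hl
    refine Prod.ext ?_ ?_
    · simp only [cylMap, h, add_sub_cancel_right]
    · simp only [cylMap, h, add_sub_cancel_right]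
  right_inv z := by
    refine Prod.ext ?_ ?_
    · simp only [cylMap, sub_add_cancel]
    · simp only [cylMap, sub_add_cancel]
      exact mul_div_cancel₀ _ hl

/-! ### Full orbits of a bijection -/

section Orbits

variable {α : Type*}

theorem Equiv.Perm.orbit_eq_zpow (e : Equiv.Perm α) {o : ℤ → α} (ho : ∀ n, o (n + 1) = e (o n))
    (n : ℤ) : o n = (e ^ n) (o 0) := by
  induction n with
  | zero => rfl
  | succ n ih => rw [ho, ih, add_comm, zpow_add, zpow_one, Equiv.Perm.mul_apply]
  | pred n ih =>
    apply e.injective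
    rw [← ho, sub_add_cancel, ih, ← Equiv.Perm.mul_apply, ← zpow_one_add]
    congr 2
    ring

/-- On a periodic orbit, the past is part of the future. -/
theorem Equiv.Perm.zpow_eq_iterate_of_periodic (e : Equiv.Perm α) {z : α} {m : ℕ} (hm : 0 < m)
    (hz : e^[m] z = z) (n : ℤ) : ∃ j < m, (e ^ n) z = e^[j] z := by
  have hm' : (0 : ℤ) < m := by exact_mod_cast hm
  have h1 : (e ^ (m : ℤ)) z = z := by
    rw [zpow_natCast, ← Equiv.Perm.iterate_eq_pow]
    exact hz
  have h2 : (e ^ ((m : ℤ) * (n / m))) z = z := by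
    rw [zpow_mul]
    exact Equiv.Perm.zpow_apply_eq_self_of_apply_eq_self h1 _
  have h3 := Int.emod_nonneg n hm'.ne'
  have h4 := Int.emod_lt_of_pos n hm'
  refine ⟨(n % m).toNat, by omega, ?_⟩
  rw [Equiv.Perm.iterate_eq_pow, ← zpow_natCast, Int.toNat_of_nonneg h3]
  conv_lhs => rw [← Int.emod_add_mul_ediv n m, zpow_add, Equiv.Perm.mul_apply, h2]

/-- The set of points with a given shift-invariant property of the full orbit is invariant. -/
theorem Equiv.Perm.image_setOf_orbit (e : Equiv.Perm α) (Q : (ℤ → α) → Prop)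
    (hQ : ∀ (o : ℤ → α) (k : ℤ), Q o → Q fun n => o (n + k)) :
    e '' {z | Q fun n => (e ^ n) z} = {z | Q fun n => (e ^ n) z} := by
  have key : ∀ (z : α) (k : ℤ), (Q fun n => (e ^ n) z) → Q fun n => (e ^ n) ((e ^ k) z) := by
    intro z k h
    simpa only [zpow_add, Equiv.Perm.mul_apply] using hQ _ k h
  ext z
  constructor
  · rintro ⟨w, hw, rfl⟩
    simpa using key w 1 hw
  · intro hz
    refine ⟨(e ^ (-1 : ℤ)) z, key z (-1) hz, ?_⟩
    simp

end Orbits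

/-! ### Invariance of the three components -/

section Components

variable {a lam : ℝ}

/-- By bijectivity the full orbit through a point is unique, so the existential over orbits
disappears. -/
theorem setOf_fullOrbit_eq (hl : lam ≠ 0) (Q : (ℤ → Cylinder) → Prop) :
    {z | ∃ o, IsFullOrbit (cylMap a lam) o ∧ o 0 = z ∧ Q o} =
      {z | Q fun n => (cylPerm a hl ^ n) z} := by
  ext z
  constructor
  · rintro ⟨o, ho, rfl, hQ⟩
    have : o = fun n => (cylPerm a hl ^ n) (o 0) :=
      funext fun n => Equiv.Perm.orbit_eq_zpow (cylPerm a hl) ho n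
    rw [this] at hQ
    exact hQ
  · intro hQ
    refine ⟨_, fun n => ?_, ?_, hQ⟩
    · rw [add_comm, zpow_add, zpow_one]
      rfl
    · rfl

theorem oscillatingPart_eq (hl : lam ≠ 0) :
    oscillatingPart a lam = {z | ∀ n : ℤ, (cylPerm a hl ^ n) z ∈ cylP a lam} :=
  setOf_fullOrbit_eq hl fun o => ∀ n, o n ∈ cylP a lam

theorem rotatingPart_eq (hl : lam ≠ 0) :
    rotatingPart a lam = {z | ∀ n : ℤ, (cylPerm a hl ^ n) z ∈ annulusR a lam \ cylP a lam} :=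
  setOf_fullOrbit_eq hl fun o => ∀ n, o n ∈ annulusR a lam \ cylP a lam

theorem rotatingOscillatingPart_eq (hl : lam ≠ 0) :
    rotatingOscillatingPart a lam = {z | (∀ n : ℤ, (cylPerm a hl ^ n) z ∈ annulusR a lam) ∧
      (∃ m : ℤ, (cylPerm a hl ^ m) z ∈ cylP a lam) ∧
      ∃ n : ℤ, (cylPerm a hl ^ n) z ∈ annulusR a lam \ cylP a lam} :=
  setOf_fullOrbit_eq hl fun o => (∀ n, o n ∈ annulusR a lam) ∧ (∃ m, o m ∈ cylP a lam) ∧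
    ∃ n, o n ∈ annulusR a lam \ cylP a lam

theorem image_oscillatingPart (hl : lam ≠ 0) :
    cylMap a lam '' oscillatingPart a lam = oscillatingPart a lam := by
  rw [oscillatingPart_eq hl]
  exact (cylPerm a hl).image_setOf_orbit (fun o => ∀ n, o n ∈ cylP a lam) fun o k h n => h _

theorem image_rotatingPart (hl : lam ≠ 0) :
    cylMap a lam '' rotatingPart a lam = rotatingPart a lam := by
  rw [rotatingPart_eq hl]
  exact (cylPerm a hl).image_setOf_orbit (fun o => ∀ n, o n ∈ annulusR a lam \ cylP a lam)
    fun o k h n => h _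

theorem image_rotatingOscillatingPart (hl : lam ≠ 0) :
    cylMap a lam '' rotatingOscillatingPart a lam = rotatingOscillatingPart a lam := by
  rw [rotatingOscillatingPart_eq hl]
  refine (cylPerm a hl).image_setOf_orbit (fun o => (∀ n, o n ∈ annulusR a lam) ∧
    (∃ m, o m ∈ cylP a lam) ∧ ∃ n, o n ∈ annulusR a lam \ cylP a lam) ?_
  rintro o k ⟨h1, ⟨m, hm⟩, n, hn⟩
  exact ⟨fun n => h1 _, ⟨m - k, by simpa using hm⟩, ⟨n - k, by simpa using hn⟩⟩

end Components

/-! ### The trapping domain -/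

theorem abs_circleSawtooth_le {a : ℝ} (ha : 0 ≤ a) (x : AddCircle (2 : ℝ)) :
    |circleSawtooth a x| ≤ a := by
  obtain ⟨x, rfl⟩ := QuotientAddGroup.mk_surjective x
  have h : circleSawtooth a ((x : ℝ) : AddCircle (2 : ℝ)) = sawtooth a x :=
    (sawtooth_periodic a).lift_coe x
  change |circleSawtooth a ((x : ℝ) : AddCircle (2 : ℝ))| ≤ a
  rw [h, sawtooth, abs_mul, abs_of_nonneg ha]
  refine mul_le_of_le_one_right ha (abs_le.2 ⟨?_, ?_⟩)
  · linarith [Int.floor_le (x / 2)]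
  · linarith [Int.lt_floor_add_one (x / 2)]

section Trapping

variable {a lam : ℝ} (h : Params a lam)
include h

theorem abs_cylMap_snd_le (z : Cylinder) : |(cylMap a lam z).2| ≤ lam * (|z.2| + a) := by
  simp only [cylMap]
  rw [abs_mul, abs_of_pos h.lam_pos]
  refine mul_le_mul_of_nonneg_left ?_ h.lam_pos.le
  exact (abs_add_le _ _).trans (by gcongr; exact abs_circleSawtooth_le h.a_pos.le _)

/-- With `c = a / (1 - λ)`, the left side is `c * (1 - (1 - λ)²)`. -/
theorem trapping_bound_lt : lam * (a / (1 - lam) + a) < a / (1 - lam) := by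
  have h0 : 0 < 1 - lam := by linarith [h.lam_lt]
  have h1 : a = a / (1 - lam) * (1 - lam) := by field_simp
  have h2 : 0 < a / (1 - lam) := div_pos h.a_pos h0
  have h3 := mul_pos h2 (pow_pos h0 2)
  nlinarith

theorem closure_image_annulusR : closure (cylMap a lam '' annulusR a lam) ⊆ annulusR a lam := by
  have hcl : IsClosed {z : Cylinder | |z.2| ≤ lam * (a / (1 - lam) + a)} :=
    isClosed_le (continuous_abs.comp continuous_snd) continuous_const
  refine (closure_minimal ?_ hcl).trans ?_
  · rintro _ ⟨z, hz, rfl⟩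
    refine (abs_cylMap_snd_le h z).trans (mul_le_mul_of_nonneg_left ?_ h.lam_pos.le)
    have : |z.2| < a / (1 - lam) := hz
    linarith
  · intro z hz
    exact lt_of_le_of_lt hz (trapping_bound_lt h)

theorem cylMap_mem_annulusR {z : Cylinder} (hz : z ∈ annulusR a lam) :
    cylMap a lam z ∈ annulusR a lam :=
  closure_image_annulusR h (subset_closure ⟨z, hz, rfl⟩)

theorem iterate_mem_annulusR {z : Cylinder} (hz : z ∈ annulusR a lam) (n : ℕ) :
    (cylMap a lam)^[n] z ∈ annulusR a lam := by
  induction n with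
  | zero => exact hz
  | succ n ih =>
    rw [Function.iterate_succ_apply']
    exact cylMap_mem_annulusR h ih

theorem exists_iterate_mem_annulusR (z : Cylinder) :
    ∃ n : ℕ, (cylMap a lam)^[n] z ∈ annulusR a lam := by
  have h0 : 0 < 1 - lam := by linarith [h.lam_lt]
  set c := a / (1 - lam) with hc
  have h1 : a = c * (1 - lam) := by
    simp only [hc]
    field_simp
  have hcpos : 0 < c := div_pos h.a_pos h0
  -- The constant `λc < c` is the fixed point of `t ↦ λ(t + a)`, which dominates `|y|` along orbits.
  have hb : ∀ n : ℕ, |((cylMap a lam)^[n] z).2| ≤ lam ^ n * |z.2| + lam * c := by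
    intro n
    induction n with
    | zero =>
      have := mul_pos h.lam_pos hcpos
      simp only [Function.iterate_zero, id, pow_zero, one_mul]
      linarith
    | succ n ih =>
      rw [Function.iterate_succ_apply']
      refine (abs_cylMap_snd_le h _).trans ?_
      have := mul_le_mul_of_nonneg_left ih h.lam_pos.le
      rw [pow_succ]
      nlinarith
  have ht : Tendsto (fun n : ℕ => lam ^ n * |z.2| + lam * c) atTop (𝓝 (0 * |z.2| + lam * c)) :=
    ((tendsto_pow_atTop_nhds_zero_of_lt_one h.lam_pos.le h.lam_lt).mul_const _).add_const _
  have hlt : 0 * |z.2| + lam * c < c := by nlinarith [h.lam_lt]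
  obtain ⟨n, hn⟩ := (ht.eventually (gt_mem_nhds hlt)).exists
  exact ⟨n, (hb n).trans_lt hn⟩

omit h in
theorem isCompact_closure_annulusR : IsCompact (closure (annulusR a lam)) := by
  have hK : IsCompact ((univ : Set (AddCircle (2 : ℝ))) ×ˢ
      Icc (-(a / (1 - lam))) (a / (1 - lam))) := by
    have : Fact (0 < (2 : ℝ)) := ⟨two_pos⟩
    exact isCompact_univ.prod isCompact_Icc
  refine hK.closure_of_subset ?_
  intro z hz
  exact ⟨mem_univ _, abs_le.1 (le_of_lt hz)⟩

omit h in
theorem isOpen_annulusR : IsOpen (annulusR a lam) :=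
  isOpen_lt (continuous_abs.comp continuous_snd) continuous_const

theorem cylP_subset_annulusR : cylP a lam ⊆ annulusR a lam := by
  have h0 : 0 < 1 - lam := by linarith [h.lam_lt]
  have hpos : 0 < a / (1 - lam) := div_pos h.a_pos h0
  have hy := h.yM₂_lt
  have hy0 := h.yM₂_pos
  have hconv : Convex ℝ {p : ℝ × ℝ | p.2 ∈ Ioo (-(a / (1 - lam))) (a / (1 - lam))} :=
    (convex_Ioo _ _).linear_preimage (LinearMap.snd ℝ ℝ ℝ)
  have hsub : planeP a lam ⊆ {p : ℝ × ℝ | p.2 ∈ Ioo (-(a / (1 - lam))) (a / (1 - lam))} := by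
    refine convexHull_min ?_ hconv
    rintro q (rfl | rfl | rfl | rfl)
    · exact ⟨by simpa using hpos, hpos⟩
    · exact ⟨by simp only; linarith, hy⟩
    · exact ⟨by simpa using hpos, hpos⟩
    · exact ⟨by simp only; linarith, by simp only; linarith⟩
  rintro _ ⟨p, hp, rfl⟩
  exact abs_lt.2 (hsub hp)

/-- Membership in the images gives arbitrarily early backward iterates in `R`, and forward
invariance fills in all later times. -/
theorem attractorOf_eq :
    attractorOf (cylMap a lam) (annulusR a lam) =
      {z | ∀ n : ℤ, (cylPerm a h.lam_pos.ne' ^ n) z ∈ annulusR a lam} := by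
  set e := cylPerm a h.lam_pos.ne' with he
  have hit : ∀ (n : ℕ) (z : Cylinder), (cylMap a lam)^[n] z = (e ^ (n : ℤ)) z := by
    intro n z
    rw [zpow_natCast, ← Equiv.Perm.iterate_eq_pow]
    rfl
  ext z
  constructor
  · intro hz
    have hneg : ∀ k : ℕ, (e ^ (-((k : ℤ) + 1))) z ∈ annulusR a lam := by
      intro k
      obtain ⟨w, hw, hwz⟩ := mem_iInter.1 hz k
      rw [hit] at hwz
      rw [← hwz, ← Equiv.Perm.mul_apply, ← zpow_add]
      simpa using hw
    intro n
    obtain ⟨k, hk⟩ : ∃ k : ℕ, -((k : ℤ) + 1) ≤ n := ⟨n.natAbs, by omega⟩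
    obtain ⟨j, hj⟩ := Int.le.dest hk
    have := iterate_mem_annulusR h (hneg k) j
    rw [hit, ← Equiv.Perm.mul_apply, ← zpow_add, add_comm, hj] at this
    exact this
  · intro hz
    refine mem_iInter.2 fun k => ⟨(e ^ (-((k : ℤ) + 1))) z, hz _, ?_⟩
    rw [hit, ← Equiv.Perm.mul_apply, ← zpow_add]
    simp

theorem image_attractorOf :
    cylMap a lam '' attractorOf (cylMap a lam) (annulusR a lam) =
      attractorOf (cylMap a lam) (annulusR a lam) := by
  rw [attractorOf_eq h]
  exact (cylPerm a h.lam_pos.ne').image_setOf_orbit (fun o => ∀ n, o n ∈ annulusR a lam)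
    fun o k h n => h _

theorem attractorOf_eq_union :
    attractorOf (cylMap a lam) (annulusR a lam) =
      oscillatingPart a lam ∪ rotatingPart a lam ∪ rotatingOscillatingPart a lam := by
  rw [attractorOf_eq h, oscillatingPart_eq h.lam_pos.ne', rotatingPart_eq h.lam_pos.ne',
    rotatingOscillatingPart_eq h.lam_pos.ne']
  ext z
  constructor
  · intro hz
    by_cases h1 : ∀ n : ℤ, (cylPerm a h.lam_pos.ne' ^ n) z ∈ cylP a lam
    · exact Or.inl (Or.inl h1)
    by_cases h2 : ∀ n : ℤ, (cylPerm a h.lam_pos.ne' ^ n) z ∉ cylP a lam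
    · exact Or.inl (Or.inr fun n => ⟨hz n, h2 n⟩)
    push Not at h1 h2
    obtain ⟨n, hn⟩ := h1
    exact Or.inr ⟨hz, h2, n, hz n, hn⟩
  · rintro ((hz | hz) | hz)
    · exact fun n => cylP_subset_annulusR h (hz n)
    · exact fun n => (hz n).1
    · exact hz.1

theorem disjoint_oscillating_rotating :
    Disjoint (oscillatingPart a lam) (rotatingPart a lam) := by
  rw [oscillatingPart_eq h.lam_pos.ne', rotatingPart_eq h.lam_pos.ne', Set.disjoint_left]
  exact fun z h1 h2 => (h2 0).2 (h1 0)

theorem disjoint_oscillating_rotatingOscillating :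
    Disjoint (oscillatingPart a lam) (rotatingOscillatingPart a lam) := by
  rw [oscillatingPart_eq h.lam_pos.ne', rotatingOscillatingPart_eq h.lam_pos.ne',
    Set.disjoint_left]
  rintro z h1 ⟨-, -, n, hn⟩
  exact hn.2 (h1 n)

theorem disjoint_rotating_rotatingOscillating :
    Disjoint (rotatingPart a lam) (rotatingOscillatingPart a lam) := by
  rw [rotatingPart_eq h.lam_pos.ne', rotatingOscillatingPart_eq h.lam_pos.ne',
    Set.disjoint_left]
  rintro z h1 ⟨-, ⟨n, hn⟩, -⟩
  exact (h1 n).2 hn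

/-- The attractor meets the discontinuity line: it contains the point where the unstable line of
`O₁` meets it. -/
theorem attractorOf_inter_discontinuityLine :
    (attractorOf (cylMap a lam) (annulusR a lam) ∩ discontinuityLine).Nonempty := by
  have hμ := h.one_lt_eigU
  have hμ0 : 0 < eigU a lam := by linarith
  refine ⟨cylProj (eigenPt a lam (-1) 1 0), mem_iInter.2 fun k => ?_, ?_⟩
  · refine ⟨cylProj (eigenPt a lam (-1) ((eigU a lam ^ (k + 1))⁻¹) 0), ?_, ?_⟩
    · refine cylP_subset_annulusR h ?_
      have := eigenPt_mem_cylP_of_nonneg h 0 (ξ := (eigU a lam ^ (k + 1))⁻¹) (η := 0)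
        (by positivity) ?_ le_rfl (by linarith [h.xM₂_lt_one])
      · simpa using this
      · have : (eigU a lam ^ (k + 1))⁻¹ ≤ 1 := inv_le_one_of_one_le₀ (one_le_pow₀ hμ.le)
        linarith [h.xM₂_pos]
    · have hpos : 0 < (eigU a lam ^ (k + 1))⁻¹ := by positivity
      -- The final point `ξ = 1` is on the edge of the strip, but only times up to `k` have to be
      -- inside.
      have := planeMap_iterate_eigenPt h 0 (ξ := (eigU a lam ^ (k + 1))⁻¹) (η := 0) (N := k) ?_ ?_
        (le_refl (k + 1))
      · rw [← cylProj_planeMap_iterate]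
        rw [mul_inv_cancel₀ (by positivity), mul_zero] at this
        norm_num at this ⊢
        rw [this]
      · rw [abs_of_pos hpos, abs_zero, add_zero]
        exact inv_lt_one_of_one_lt₀ (one_lt_pow₀ hμ (by omega))
      · rw [abs_of_pos hpos, abs_zero, mul_zero, add_zero, pow_succ, mul_inv,
          mul_inv_cancel_left₀ (by positivity)]
        exact inv_lt_one_of_one_lt₀ hμ
  · simp [discontinuityLine, cylProj, eigenPt]

end Trapping

/-! ### Discontinuity and hyperbolicity -/

/-- The second coordinate jumps: the sawtooth has left limit `a` at `0` but the value `-a` there. -/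
theorem not_continuousAt_cylMap {a lam : ℝ} (h : Params a lam) {z : Cylinder}
    (hz : z ∈ discontinuityLine) : ¬ ContinuousAt (cylMap a lam) z := by
  intro hc
  obtain ⟨x, y⟩ := z
  obtain rfl : x = 0 := hz
  have h0 : (((0 : ℝ) : AddCircle (2 : ℝ)), y) = cylProj (0, y) := rfl
  have hcomp : Tendsto (fun t : ℝ => (cylMap a lam (cylProj (t, y))).2) (𝓝[<] 0)
      (𝓝 (cylMap a lam (cylProj (0, y))).2) := by
    have h1 : Tendsto (fun t : ℝ => cylProj (t, y)) (𝓝 0) (𝓝 (cylProj (0, y))) :=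
      (continuous_cylProj.comp (continuous_id.prodMk continuous_const)).tendsto _
    have h2 : Tendsto (cylMap a lam) (𝓝 (cylProj (0, y))) (𝓝 (cylMap a lam (cylProj (0, y)))) :=
      hc
    exact ((continuous_snd.tendsto _).comp (h2.comp h1)).mono_left nhdsWithin_le_nhds
  have hval : ∀ t : ℝ, (cylMap a lam (cylProj (t, y))).2 = lam * (y + sawtooth a t) := fun t => by
    rw [← cylProj_planeMap]
    rfl
  simp only [hval] at hcomp
  have hleft : Tendsto (fun t : ℝ => lam * (y + sawtooth a t)) (𝓝[<] 0)
      (𝓝 (lam * (y + a * (0 + 1)))) := by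
    have h1 : Tendsto (fun t : ℝ => lam * (y + a * (t + 1))) (𝓝[<] 0)
        (𝓝 (lam * (y + a * (0 + 1)))) :=
      ((by fun_prop : Continuous fun t : ℝ => lam * (y + a * (t + 1))).tendsto 0).mono_left
        nhdsWithin_le_nhds
    refine h1.congr' ?_
    filter_upwards [Ioo_mem_nhdsLT (show (-2 : ℝ) < 0 by norm_num)] with t ht
    rw [sawtooth_eq a t 0 (by push_cast; linarith [ht.1]) (by push_cast; linarith [ht.2])]
    push_cast
    ring
  have heq := tendsto_nhds_unique hcomp hleft
  rw [sawtooth_eq a 0 1 (by norm_num) (by norm_num)] at heq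
  have := mul_left_cancel₀ h.lam_pos.ne' heq
  push_cast at this
  linarith [h.a_pos]

/-- The constant linear part of the map. -/
noncomputable def linearPart (a : ℝ) {lam : ℝ} (hl : lam ≠ 0) : (ℝ × ℝ) ≃L[ℝ] (ℝ × ℝ) :=
  LinearEquiv.toContinuousLinearEquiv
    { toFun := fun u => ((1 + a) * u.1 + u.2, lam * (a * u.1 + u.2))
      invFun := fun u => (u.1 - u.2 / lam, u.2 / lam - a * (u.1 - u.2 / lam))
      map_add' := fun u v => by
        refine Prod.ext ?_ ?_ <;> simp only [Prod.fst_add, Prod.snd_add] <;> ring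
      map_smul' := fun c u => by
        refine Prod.ext ?_ ?_ <;>
          simp only [Prod.smul_fst, Prod.smul_snd, smul_eq_mul, RingHom.id_apply] <;> ring
      left_inv := fun u => by
        refine Prod.ext ?_ ?_ <;> simp only <;> field_simp <;> ring
      right_inv := fun u => by
        refine Prod.ext ?_ ?_ <;> simp only <;> field_simp <;> ring }

theorem linearPart_apply (a : ℝ) {lam : ℝ} (hl : lam ≠ 0) (u : ℝ × ℝ) :
    linearPart a hl u = ((1 + a) * u.1 + u.2, lam * (a * u.1 + u.2)) := rfl

theorem linearPart_symm_apply (a : ℝ) {lam : ℝ} (hl : lam ≠ 0) (u : ℝ × ℝ) :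
    (linearPart a hl).symm u = (u.1 - u.2 / lam, u.2 / lam - a * (u.1 - u.2 / lam)) := rfl

theorem hasLinearizationAt_cylMap (a : ℝ) {lam : ℝ} (hl : lam ≠ 0) {z : Cylinder}
    (hz : z ∉ discontinuityLine) :
    HasLinearizationAt (cylMap a lam)
      (linearPart a hl : (ℝ × ℝ) →L[ℝ] (ℝ × ℝ)) z := by
  obtain ⟨p, rfl⟩ := cylProj_surjective z
  set k : ℤ := ⌊p.1 / 2⌋ with hk
  have hne : p.1 ≠ 2 * k := by
    intro he
    refine hz ?_
    change ((p.1 : ℝ) : AddCircle (2 : ℝ)) = 0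
    exact (AddCircle.coe_eq_zero_iff _).2 ⟨k, by rw [zsmul_eq_mul, he, mul_comm]⟩
  have hlo : 2 * (k : ℝ) < p.1 :=
    lt_of_le_of_ne (by linarith [Int.floor_le (p.1 / 2)]) hne.symm
  have hhi : p.1 < 2 * (k : ℝ) + 2 := by linarith [Int.lt_floor_add_one (p.1 / 2)]
  -- The local lift is affine and fixes the strip centre `c`. As `k` is the floor, the strip has
  -- index `k + 1` in `sawtooth_eq`.
  set c : ℝ × ℝ := (2 * k + 1, 0) with hc
  refine ⟨p, fun q => linearPart a hl (q - c) + c, rfl, ?_, ?_, ?_⟩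
  · have hnhds : ∀ᶠ q : ℝ × ℝ in 𝓝 p, q.1 ∈ Ioo (2 * (k : ℝ)) (2 * k + 2) :=
      continuous_fst.continuousAt.eventually (Ioo_mem_nhds hlo hhi)
    filter_upwards [hnhds] with q hq
    rw [← cylProj_planeMap]
    congr 1
    have hs : sawtooth a q.1 = a * (q.1 - (2 * k + 1)) := by
      rw [sawtooth_eq a q.1 (k + 1) (by push_cast; linarith [hq.1]) (by push_cast; linarith [hq.2])]
      push_cast
      ring
    rw [linearPart_apply]
    refine Prod.ext ?_ ?_
    · simp only [planeMap, hs, hc, Prod.fst_add, Prod.fst_sub, Prod.snd_sub]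
      ring
    · simp only [planeMap, hs, hc, Prod.snd_add, Prod.fst_sub, Prod.snd_sub]
      ring
  · exact (((linearPart a hl).contDiff.comp (contDiff_id.sub contDiff_const)).add
      contDiff_const).contDiffAt
  · exact ((linearPart a hl).hasFDerivAt.comp p ((hasFDerivAt_id p).sub_const c)).add_const c

theorem isPlaneCone_pos : IsPlaneCone {u : ℝ × ℝ | 0 < u.1 * u.2} := by
  refine ⟨(1, 0), (0, 1), ?_, ?_⟩
  · rw [LinearIndependent.pair_iff]
    intro s t hst
    simpa using hst
  · ext ⟨x, y⟩
    constructor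
    · intro hu
      exact ⟨x, y, hu, by simp⟩
    · rintro ⟨s, t, hst, he⟩
      simp only [Prod.smul_mk, Prod.mk_add_mk, smul_eq_mul, mul_one, mul_zero, add_zero, zero_add,
        Prod.mk.injEq] at he
      obtain ⟨rfl, rfl⟩ := he
      exact hst

theorem isPlaneCone_neg : IsPlaneCone {u : ℝ × ℝ | u.1 * u.2 < 0} := by
  refine ⟨(1, 0), (0, -1), ?_, ?_⟩
  · rw [LinearIndependent.pair_iff]
    intro s t hst
    simpa using hst
  · ext ⟨x, y⟩
    constructor
    · intro hu
      refine ⟨x, -y, ?_, by simp⟩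
      have : x * y < 0 := hu
      linarith
    · rintro ⟨s, t, hst, he⟩
      simp only [Prod.smul_mk, Prod.mk_add_mk, smul_eq_mul, mul_one, mul_zero, add_zero, zero_add,
        Prod.mk.injEq] at he
      obtain ⟨rfl, rfl⟩ := he
      change x * (t * -1) < 0
      linarith

theorem mul_euclNorm_le {ν : ℝ} (hν : 0 ≤ ν) {u v : ℝ × ℝ}
    (huv : ν * (u.1 ^ 2 + u.2 ^ 2) ≤ v.1 ^ 2 + v.2 ^ 2) :
    Real.sqrt ν * euclNorm u ≤ euclNorm v := by
  unfold euclNorm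
  rw [← Real.sqrt_mul hν]
  exact Real.sqrt_le_sqrt huv

/-- All entries of the matrix are positive, so the quadrants `xy > 0` serve as unstable cone and `xy
< 0` as stable cone; there the cross terms only increase the norm of the image under the map,
respectively its inverse. -/
theorem isHyperbolicOn_cylMap {a lam : ℝ} (h : Params a lam) {G : Set Cylinder}
    (hG : Disjoint G discontinuityLine) : IsHyperbolicOn (cylMap a lam) G := by
  have ha := h.a_pos
  have hl := h.lam_pos
  have hinv : 1 < (1 / lam) ^ 2 := by
    have : 1 < 1 / lam := (one_lt_div hl).2 h.lam_lt
    nlinarith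
  -- Lower bounds for the coefficients of `x²` and `y²` in the squared norm of the image, first for
  -- the map, then for its inverse; hence the rate `√ν`.
  set ν := min (min ((1 + a) ^ 2) (1 + lam ^ 2)) (min (1 + a ^ 2) ((1 / lam) ^ 2)) with hν
  have hν1 : 1 < ν := by
    refine lt_min (lt_min ?_ ?_) (lt_min ?_ hinv) <;> nlinarith
  have n1 : ν ≤ (1 + a) ^ 2 := (min_le_left _ _).trans (min_le_left _ _)
  have n2 : ν ≤ 1 + lam ^ 2 := (min_le_left _ _).trans (min_le_right _ _)
  have n3 : ν ≤ 1 + a ^ 2 := (min_le_right _ _).trans (min_le_left _ _)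
  have n4 : ν ≤ (1 / lam) ^ 2 := (min_le_right _ _).trans (min_le_right _ _)
  clear_value ν
  refine ⟨{u | 0 < u.1 * u.2}, {u | u.1 * u.2 < 0}, Real.sqrt ν, isPlaneCone_pos,
    isPlaneCone_neg, ?_, Real.lt_sqrt_of_sq_lt (by linarith), fun z hz => ?_⟩
  · rw [Set.disjoint_left]
    exact fun u hu hu' => lt_asymm (show 0 < u.1 * u.2 from hu) hu'
  refine ⟨linearPart a hl.ne', hasLinearizationAt_cylMap a hl.ne'
    (Set.disjoint_left.1 hG hz), ?_, ?_⟩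
  · rintro ⟨x, y⟩ hu
    have hxy : 0 < x * y := hu
    rw [linearPart_apply]
    constructor
    · change 0 < ((1 + a) * x + y) * (lam * (a * x + y))
      have : 0 < (1 + a) * a * x ^ 2 + (1 + 2 * a) * (x * y) + y ^ 2 := by positivity
      have := mul_pos hl this
      linarith
    · refine mul_euclNorm_le (by linarith) ?_
      simp only
      have e1 : 0 ≤ ((1 + a) ^ 2 - ν) * x ^ 2 := mul_nonneg (by linarith) (sq_nonneg x)
      have e2 : 0 ≤ (1 + lam ^ 2 - ν) * y ^ 2 := mul_nonneg (by linarith) (sq_nonneg y)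
      have e3 : 0 ≤ 2 * (1 + a) * (x * y) + lam ^ 2 * (a ^ 2 * x ^ 2 + 2 * a * (x * y)) := by
        positivity
      linarith
  · rintro ⟨x, y⟩ hu
    have hxy : x * y < 0 := hu
    rw [linearPart_symm_apply]
    obtain ⟨w, rfl⟩ : ∃ w, y = lam * w := ⟨y / lam, by field_simp⟩
    have hw : x * w < 0 := by
      by_contra! hc
      have := mul_nonneg hl.le hc
      linarith
    have hd : lam * w / lam = w := mul_div_cancel_left₀ _ hl.ne'
    simp only [hd]
    constructor
    · change (x - w) * (w - a * (x - w)) < 0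
      have : 0 ≤ (1 + a) * w ^ 2 + a * x ^ 2 := by positivity
      have : 0 < (1 + 2 * a) * -(x * w) := mul_pos (by linarith) (by linarith)
      linarith
    · refine mul_euclNorm_le (by linarith) ?_
      simp only
      have n4' : ν * lam ^ 2 ≤ 1 := by
        have := mul_le_mul_of_nonneg_right n4 (sq_nonneg lam)
        rwa [div_pow, one_pow, one_div, inv_mul_cancel₀ (by positivity)] at this
      have e1 : 0 ≤ (1 + a ^ 2 - ν) * x ^ 2 := mul_nonneg (by linarith) (sq_nonneg x)
      have e2 : 0 ≤ (1 - ν * lam ^ 2) * w ^ 2 := mul_nonneg (by linarith) (sq_nonneg w)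
      have e3 : 0 ≤ (2 + 2 * a * (1 + a)) * -(x * w) :=
        mul_nonneg (by positivity) (by linarith)
      have e4 : 0 ≤ (1 + a) ^ 2 * w ^ 2 := by positivity
      linarith

theorem isSingularHyperbolicAttractor_cylMap {a lam : ℝ} (h : Params a lam) :
    IsSingularHyperbolicAttractor (cylMap a lam) discontinuityLine (annulusR a lam)
      (attractorOf (cylMap a lam) (annulusR a lam)) where
  isOpen_domain := isOpen_annulusR
  isCompact_closure := isCompact_closure_annulusR
  trapping := closure_image_annulusR h
  absorbing := exists_iterate_mem_annulusR h
  eq_attractorOf := rfl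
  nonempty := (attractorOf_inter_discontinuityLine h).mono inter_subset_left
  invariant := image_attractorOf h
  hyperbolic := isHyperbolicOn_cylMap h disjoint_sdiff_left
  discontinuous := fun _ => not_continuousAt_cylMap h
  singular := attractorOf_inter_discontinuityLine h

/-! ### Lifted orbits -/

section Lifts

variable {a lam : ℝ}

/-- Lifts of orbits in the oscillating component stay in one lift of `P`. -/
theorem abs_liftX_sub_le (h : Params a lam) {p : ℝ × ℝ} (hp : cylProj p ∈ oscillatingPart a lam)
    (n : ℕ) : |liftX a lam p n - p.1| ≤ 2 := by
  rw [oscillatingPart_eq h.lam_pos.ne'] at hp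
  have hmem : ∀ n : ℕ, cylProj ((planeMap a lam)^[n] p) ∈ cylP a lam := by
    intro n
    have := hp n
    rw [zpow_natCast, ← Equiv.Perm.iterate_eq_pow] at this
    rw [cylProj_planeMap_iterate]
    exact this
  obtain ⟨k, ξ, η, b1, b2, b3, b4, he⟩ := (cylProj_mem_cylP_iff h).1 (hmem 0)
  have hbox : ∀ n : ℕ, ∃ ξ' η' : ℝ, 0 ≤ ξ' ∧ ξ' ≤ 1 + xM₂ a lam ∧ 0 ≤ η' ∧ η' ≤ 1 - xM₂ a lam ∧
      (planeMap a lam)^[n] p = eigenPt a lam (2 * k - 1) ξ' η' := by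
    intro n
    induction n with
    | zero => exact ⟨ξ, η, b1, b2, b3, b4, he⟩
    | succ n ih =>
      obtain ⟨ξ', η', c1, c2, c3, c4, hn⟩ := ih
      have hs := hmem (n + 1)
      rw [Function.iterate_succ_apply', hn] at hs ⊢
      exact planeMap_mem_same_lift h k c1 c2 c3 c4 hs
  obtain ⟨ξ', η', c1, c2, c3, c4, hn⟩ := hbox n
  have hp1 : p.1 = 2 * k - 1 + ξ + η := congrArg Prod.fst he
  have hn1 : liftX a lam p n = 2 * k - 1 + ξ' + η' := congrArg Prod.fst hn
  -- On a lift of `P` the sum `ξ + η` ranges over `[0, 2]`.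
  rw [hp1, hn1, abs_le]
  constructor <;> linarith

theorem planeMap_add_period (a lam : ℝ) (p : ℝ × ℝ) :
    planeMap a lam (p + (2, 0)) = planeMap a lam p + (2, 0) := by
  have hs := sawtooth_periodic a p.1
  refine Prod.ext ?_ ?_
  · simp only [planeMap, Prod.fst_add, Prod.snd_add, hs]
    ring
  · simp only [planeMap, Prod.fst_add, Prod.snd_add, hs, add_zero]

theorem planeMap_iterate_add_period (a lam : ℝ) (p : ℝ × ℝ) (n : ℕ) :
    (planeMap a lam)^[n] (p + (2, 0)) = (planeMap a lam)^[n] p + (2, 0) := by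
  induction n with
  | zero => rfl
  | succ n ih => rw [Function.iterate_succ_apply', Function.iterate_succ_apply', ih,
      planeMap_add_period]

theorem cylProj_add_period (p : ℝ × ℝ) : cylProj (p + (2, 0)) = cylProj p :=
  cylProj_eq_iff.2 ⟨1, by simp⟩

theorem tendsto_abs_atTop_of_add_eq {u : ℕ → ℝ} {m : ℕ} (hm : 0 < m)
    (hu : ∀ n, u (n + m) = u n + 2) : Tendsto (fun n => |u n|) atTop atTop := by
  have hmul : ∀ r q : ℕ, u (r + m * q) = u r + 2 * q := by
    intro r q
    induction q with
    | zero => simp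
    | succ q ih =>
      rw [Nat.mul_succ, ← add_assoc, hu, ih]
      push_cast
      ring
  obtain ⟨C, hC⟩ : ∃ C : ℝ, ∀ r < m, C ≤ u r := by
    obtain ⟨C, hC⟩ := ((Finset.range m).image u).bddBelow
    exact ⟨C, fun r hr => hC (by simpa using ⟨r, hr, rfl⟩)⟩
  have hdiv : Tendsto (fun n : ℕ => C + 2 * ((n / m : ℕ) : ℝ)) atTop atTop :=
    tendsto_atTop_add_const_left _ _ ((tendsto_natCast_atTop_atTop.comp
      (Nat.tendsto_div_const_atTop hm.ne')).const_mul_atTop two_pos)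
  refine tendsto_atTop_mono (fun n => ?_) hdiv
  have h1 := hmul (n % m) (n / m)
  rw [Nat.mod_add_div] at h1
  have h2 := hC _ (Nat.mod_lt n hm)
  linarith [le_abs_self (u n)]

/-- A lifted orbit that closes up after one turn around the cylinder winds forever. -/
theorem tendsto_abs_liftX {p : ℝ × ℝ} {m : ℕ} (hm : 0 < m)
    (hp : (planeMap a lam)^[m] p = p + (2, 0)) :
    Tendsto (fun n => |liftX a lam p n|) atTop atTop := by
  refine tendsto_abs_atTop_of_add_eq hm fun n => ?_
  unfold liftX
  rw [Function.iterate_add_apply, hp, planeMap_iterate_add_period]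
  rfl

theorem cylMap_iterate_eq_self {p : ℝ × ℝ} {m : ℕ}
    (hp : (planeMap a lam)^[m] p = p + (2, 0)) :
    (cylMap a lam)^[m] (cylProj p) = cylProj p := by
  rw [← cylProj_planeMap_iterate, hp, cylProj_add_period]

theorem frequently_atTop_of_periodic {X : Type*} {f : X → X} {z : X} {m : ℕ} (hm : 0 < m)
    (hz : f^[m] z = z) {S : Set X} {j : ℕ} (hj : f^[j] z ∈ S) : ∃ᶠ n in atTop, f^[n] z ∈ S := by
  rw [frequently_atTop]
  intro n
  refine ⟨j + m * n, by nlinarith, ?_⟩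
  rw [Function.iterate_add_apply, Function.iterate_mul, Function.iterate_fixed hz]
  exact hj

/-- A periodic orbit is absorbed by `R`, cannot leave, and returns to its start, so it was in `R`
all along. -/
theorem mem_annulusR_of_periodic (h : Params a lam) {z : Cylinder} {m : ℕ} (hm : 0 < m)
    (hz : (cylMap a lam)^[m] z = z) (n : ℤ) :
    (cylPerm a h.lam_pos.ne' ^ n) z ∈ annulusR a lam := by
  obtain ⟨i, hi⟩ := exists_iterate_mem_annulusR h z
  have hzR : z ∈ annulusR a lam := by
    have hle : i ≤ m * i := Nat.le_mul_of_pos_left i hm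
    have h1 := iterate_mem_annulusR h hi (m * i - i)
    rw [← Function.iterate_add_apply, Nat.sub_add_cancel hle, Function.iterate_mul,
      Function.iterate_fixed hz] at h1
    exact h1
  obtain ⟨j, -, hj⟩ := (cylPerm a h.lam_pos.ne').zpow_eq_iterate_of_periodic hm hz n
  rw [hj]
  exact iterate_mem_annulusR h hzR j

end Lifts

/-! ### Orbits in the three components -/

section Examples

variable {a lam : ℝ}

/-- The oscillating component contains an orbit of period two around the origin. -/
theorem exists_oscillating (h : Params a lam) :
    ∃ p, cylProj p ∈ oscillatingPart a lam ∧
      (∃ᶠ n in atTop, liftX a lam p n < 0) ∧ (∃ᶠ n in atTop, 0 < liftX a lam p n) := by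
  have hX₀ := h.xM₂_pos
  have hX₁ := h.xM₂_lt_one
  have hμ := h.one_lt_eigU
  have hν := h.eigS_pos
  have hν₁ := h.eigS_lt_one
  -- This is `ξ + η < 1` for the point below, denominators cleared; the two sides differ by `a`.
  have hsum : (1 + xM₂ a lam) * (1 + eigS a lam) + (1 - xM₂ a lam) * (1 + eigU a lam) <
      (1 + eigU a lam) * (1 + eigS a lam) := by
    have h1 := h.xM₂_mul_sqrt
    have h2 := h.sq_sqrt
    have ha := h.a_pos
    unfold eigU eigS
    set d := Real.sqrt (traceS a lam ^ 2 - 4 * lam)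
    unfold traceS
    linarith
  -- Chosen so that the image is the reflection `(A - ξ, B - η)` in the centre of `P`; by symmetry
  -- the next step returns.
  set ξ := (1 + xM₂ a lam) / (1 + eigU a lam) with hξ
  set η := (1 - xM₂ a lam) / (1 + eigS a lam) with hη
  have hξ₀ : 0 < ξ := div_pos (by linarith) (by linarith)
  have hη₀ : 0 < η := div_pos (by linarith) (by linarith)
  have eξ : eigU a lam * ξ = 1 + xM₂ a lam - ξ := by
    rw [hξ]
    field_simp
    ring
  have eη : eigS a lam * η = 1 - xM₂ a lam - η := by
    rw [hη]
    field_simp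
    ring
  have hlt : ξ + η < 1 := by
    rw [hξ, hη, div_add_div _ _ (by positivity) (by positivity), div_lt_one (by positivity)]
    linarith
  have m1 := eigenPt_mem_cylP_of_nonneg h 0 hξ₀.le (by nlinarith) hη₀.le (by nlinarith)
  have m2 := eigenPt_mem_cylP_of_nonneg h 0 (ξ := eigU a lam * ξ) (η := eigS a lam * η)
    (by positivity) (by linarith) (by positivity) (by linarith)
  have s1 := planeMap_eigenPt h 0 (ξ := ξ) (η := η) (by linarith) hlt
  have s2 := planeMap_eigenPt h 1 (ξ := -ξ) (η := -η) (by linarith) (by linarith)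
  rw [eigenPt_int_shift h 0 1, eigenPt_int_shift h 0 1 (eigU a lam * -ξ)] at s2
  have t1 : -ξ + ((1 - 0 : ℤ) : ℝ) * (1 + xM₂ a lam) = eigU a lam * ξ := by
    push_cast
    linarith
  have t2 : -η + ((1 - 0 : ℤ) : ℝ) * (1 - xM₂ a lam) = eigS a lam * η := by
    push_cast
    linarith
  have t3 : eigU a lam * -ξ + ((1 - 0 : ℤ) : ℝ) * (1 + xM₂ a lam) = ξ := by
    push_cast
    linarith
  have t4 : eigS a lam * -η + ((1 - 0 : ℤ) : ℝ) * (1 - xM₂ a lam) = η := by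
    push_cast
    linarith
  rw [t1, t2, t3, t4] at s2
  set p := eigenPt a lam (2 * (0 : ℤ) - 1) ξ η with hp
  have hper : (planeMap a lam)^[2] p = p := by
    change planeMap a lam (planeMap a lam p) = p
    rw [s1, s2]
  refine ⟨p, ?_, ?_, ?_⟩
  · rw [oscillatingPart_eq h.lam_pos.ne']
    intro n
    have hz : (cylMap a lam)^[2] (cylProj p) = cylProj p := by
      rw [← cylProj_planeMap_iterate, hper]
    obtain ⟨j, hj, hjn⟩ := (cylPerm a h.lam_pos.ne').zpow_eq_iterate_of_periodic two_pos hz n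
    rw [hjn]
    change (cylMap a lam)^[j] (cylProj p) ∈ cylP a lam
    rw [← cylProj_planeMap_iterate]
    interval_cases j
    · exact m1
    · rw [Function.iterate_one, s1]
      exact m2
  · refine frequently_atTop_of_periodic two_pos hper (S := {q | q.1 < 0}) (j := 0) ?_
    simp only [Function.iterate_zero, id, mem_ofPred_eq, hp, eigenPt]
    push_cast
    linarith
  · refine frequently_atTop_of_periodic two_pos hper (S := {q | 0 < q.1}) (j := 1) ?_
    rw [Function.iterate_one, s1]
    simp only [mem_ofPred_eq, eigenPt]
    push_cast
    linarith

/-- For long blocks, every orbit segment that enters a strip of linearity close to the stable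
line of its centre and leaves it close to the unstable line stays in the strip in between. -/
theorem exists_block_length (h : Params a lam) :
    ∃ N : ℕ, eigS a lam ^ (N + 1) ≤ 1 / 2 ∧ 2 ≤ eigU a lam ^ (N + 1) ∧
      ∀ (k ε : ℤ) (ξ η ξ' η' : ℝ), |(ε : ℝ)| = 1 →
        |ξ| ≤ (1 + xM₂ a lam) / (eigU a lam ^ (N + 1) - 1) →
        |ξ'| ≤ (1 + xM₂ a lam) / (eigU a lam ^ (N + 1) - 1) →
        |η| ≤ (1 - xM₂ a lam) / (1 - eigS a lam ^ (N + 1)) →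
        eigU a lam ^ (N + 1) * ξ = ξ' + ε * (1 + xM₂ a lam) →
        eigS a lam ^ (N + 1) * η = η' + ε * (1 - xM₂ a lam) →
        (∀ j ≤ N + 1, (planeMap a lam)^[j] (eigenPt a lam (2 * k - 1) ξ η) =
          eigenPt a lam (2 * k - 1) (eigU a lam ^ j * ξ) (eigS a lam ^ j * η)) ∧
        (planeMap a lam)^[N + 1] (eigenPt a lam (2 * k - 1) ξ η) =
          eigenPt a lam (2 * (k + ε : ℤ) - 1) ξ' η' := by
  have hX₀ := h.xM₂_pos
  have hX₁ := h.xM₂_lt_one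
  have hμ := h.one_lt_eigU
  have hν := h.eigS_pos
  have hν₁ := h.eigS_lt_one
  have hgap := h.one_add_xM₂_lt
  -- `δ` will bound `|ξ|`, `|ξ'|` and the excess of `|η|` over `1 - xM₂`. The second condition keeps
  -- the entry point in the strip, the third the last point before the exit.
  obtain ⟨δ, hδ₀, hδ₁, hδ₂⟩ : ∃ δ : ℝ, 0 < δ ∧ 2 * δ < xM₂ a lam ∧
      1 + xM₂ a lam + δ * (1 + 2 * eigU a lam) < eigU a lam := by
    have hpos : 0 < (eigU a lam - (1 + xM₂ a lam)) / (1 + 2 * eigU a lam) :=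
      div_pos (by linarith) (by linarith)
    obtain ⟨δ, h1, h2⟩ := exists_between (lt_min (half_pos hX₀) hpos)
    obtain ⟨h2, h3⟩ := lt_min_iff.1 h2
    rw [lt_div_iff₀ (by linarith)] at h3
    exact ⟨δ, h1, by linarith, by linarith⟩
  obtain ⟨N, hNp, hNq⟩ : ∃ N : ℕ, eigS a lam ^ N < min (δ / 2) (1 / 2) ∧
      1 + 2 / δ < eigU a lam ^ N :=
    (((tendsto_pow_atTop_nhds_zero_of_lt_one hν.le hν₁).eventually
      (gt_mem_nhds (lt_min (half_pos hδ₀) one_half_pos))).and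
      ((tendsto_pow_atTop_atTop_of_one_lt hμ).eventually_gt_atTop _)).exists
  obtain ⟨hNp, hNp'⟩ := lt_min_iff.1 hNp
  have hqle : eigU a lam ^ N ≤ eigU a lam ^ (N + 1) := pow_le_pow_right₀ hμ.le (by omega)
  have hple : eigS a lam ^ (N + 1) ≤ eigS a lam ^ N :=
    pow_le_pow_of_le_one hν.le hν₁.le (by omega)
  have h2δ : 1 ≤ 2 / δ := (one_le_div hδ₀).2 (by linarith)
  refine ⟨N, by linarith, by linarith, ?_⟩
  intro k ε ξ η ξ' η' hε bξ bξ' bη e1 e2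
  have hsmall : (1 + xM₂ a lam) / (eigU a lam ^ (N + 1) - 1) ≤ δ := by
    rw [div_le_iff₀ (by linarith)]
    have h1 : δ * (2 / δ) ≤ δ * (eigU a lam ^ (N + 1) - 1) :=
      mul_le_mul_of_nonneg_left (by linarith) hδ₀.le
    rw [mul_div_cancel₀ _ hδ₀.ne'] at h1
    linarith
  have hηle : (1 - xM₂ a lam) / (1 - eigS a lam ^ (N + 1)) ≤ 1 - xM₂ a lam + δ := by
    rw [div_le_iff₀ (by linarith)]
    have hp0 : 0 < eigS a lam ^ (N + 1) := by positivity
    nlinarith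
  have b1 : |ξ| + |η| < 1 := by linarith
  have b2 : eigU a lam ^ N * |ξ| + eigS a lam ^ N * |η| < 1 := by
    -- The last point inside is bounded backwards from the exit point, which gains the factor `μ > 1
    -- + xM₂`.
    have hq : eigU a lam * (eigU a lam ^ N * |ξ|) ≤ δ + (1 + xM₂ a lam) := by
      calc eigU a lam * (eigU a lam ^ N * |ξ|) = |eigU a lam ^ (N + 1) * ξ| := by
            rw [abs_mul, abs_of_pos (by positivity : 0 < eigU a lam ^ (N + 1)), pow_succ]
            ring
        _ ≤ |ξ'| + |ε * (1 + xM₂ a lam)| := by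
            rw [e1]
            exact abs_add_le _ _
        _ ≤ δ + (1 + xM₂ a lam) := by
            rw [abs_mul, hε, one_mul, abs_of_pos (by linarith : 0 < 1 + xM₂ a lam)]
            linarith
    have hp : eigS a lam ^ N * |η| ≤ δ / 2 * 2 :=
      mul_le_mul hNp.le (by linarith) (abs_nonneg _) (by linarith)
    have hp' : eigU a lam * (eigS a lam ^ N * |η|) ≤ eigU a lam * δ :=
      mul_le_mul_of_nonneg_left (by linarith) (by linarith)
    have : eigU a lam * (eigU a lam ^ N * |ξ| + eigS a lam ^ N * |η|) < eigU a lam * 1 := by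
      nlinarith
    exact lt_of_mul_lt_mul_left this (by linarith)
  refine ⟨fun j hj => planeMap_iterate_eigenPt h k b1 b2 hj, ?_⟩
  rw [planeMap_iterate_eigenPt h k b1 b2 le_rfl, eigenPt_int_shift h k (k + ε),
    add_sub_cancel_left, e1, e2]

/-- The rotating component contains a periodic orbit. -/
theorem exists_rotating (h : Params a lam) :
    ∃ p, cylProj p ∈ rotatingPart a lam ∧
      Tendsto (fun n => |liftX a lam p n|) atTop atTop := by
  have hX₀ := h.xM₂_pos
  have hX₁ := h.xM₂_lt_one
  have hμ := h.one_lt_eigU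
  have hν := h.eigS_pos
  obtain ⟨N, hp, -, hN⟩ := exists_block_length h
  have hq : 1 < eigU a lam ^ (N + 1) := one_lt_pow₀ hμ (by omega)
  -- With `q = μ ^ (N + 1)` and `r = ν ^ (N + 1)`: the solution of `qξ = ξ + A`, `rη = η + B`, for
  -- constant exits `+`. Its absolute values are the extreme ones allowed by `exists_block_length`.
  set ξ := (1 + xM₂ a lam) / (eigU a lam ^ (N + 1) - 1) with hξ
  set η := -((1 - xM₂ a lam) / (1 - eigS a lam ^ (N + 1))) with hη
  have hξ₀ : 0 < ξ := div_pos (by linarith) (by linarith)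
  have hη₀ : η < 0 := neg_neg_of_pos (div_pos (by linarith) (by linarith))
  have hq' : eigU a lam ^ (N + 1) - 1 ≠ 0 := by linarith
  have hp' : 1 - eigS a lam ^ (N + 1) ≠ 0 := by linarith
  obtain ⟨horb, hjump⟩ := hN 0 1 ξ η ξ η (by simp) (abs_of_pos hξ₀).le (abs_of_pos hξ₀).le
    (by rw [abs_of_neg hη₀, hη, neg_neg])
    (by rw [hξ]; push_cast; field_simp; ring) (by rw [hη]; push_cast; field_simp; ring)
  set p := eigenPt a lam (2 * (0 : ℤ) - 1) ξ η with hpdef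
  have hper : (planeMap a lam)^[N + 1] p = p + (2, 0) := by
    rw [hjump, hpdef]
    refine Prod.ext ?_ ?_
    · simp only [eigenPt, Prod.fst_add]
      push_cast
      ring
    · simp [eigenPt]
  have hcyc := cylMap_iterate_eq_self hper
  refine ⟨p, ?_, tendsto_abs_liftX (Nat.succ_pos N) hper⟩
  rw [rotatingPart_eq h.lam_pos.ne']
  refine fun n => ⟨mem_annulusR_of_periodic h (Nat.succ_pos N) hcyc n, ?_⟩
  obtain ⟨j, hj, hjn⟩ :=
    (cylPerm a h.lam_pos.ne').zpow_eq_iterate_of_periodic (Nat.succ_pos N) hcyc n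
  rw [hjn]
  change (cylMap a lam)^[j] (cylProj p) ∉ cylP a lam
  rw [← cylProj_planeMap_iterate, horb j hj.le]
  exact eigenPt_notMem_cylP h 0 (by positivity) (mul_neg_of_pos_of_neg (by positivity) hη₀)

/-- The rotating-with-oscillations component contains a periodic orbit: it leaves the successive
strips in the directions `+`, `-`, `+`. -/
theorem exists_rotatingOscillating (h : Params a lam) :
    ∃ p, cylProj p ∈ rotatingOscillatingPart a lam ∧
      Tendsto (fun n => |liftX a lam p n|) atTop atTop ∧
      (∃ᶠ n in atTop, (cylMap a lam)^[n] (cylProj p) ∈ cylP a lam) ∧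
      (∃ᶠ n in atTop, (cylMap a lam)^[n] (cylProj p) ∈ annulusR a lam \ cylP a lam) := by
  have hX₀ := h.xM₂_pos
  have hX₁ := h.xM₂_lt_one
  have hμ := h.one_lt_eigU
  have hν := h.eigS_pos
  obtain ⟨N, hp, hq2, hN⟩ := exists_block_length h
  have hq : 1 < eigU a lam ^ (N + 1) := one_lt_pow₀ hμ (by omega)
  have hp₀ : 0 < eigS a lam ^ (N + 1) := by positivity
  set q := eigU a lam ^ (N + 1) with hqdef
  set r := eigS a lam ^ (N + 1) with hrdef
  set A := 1 + xM₂ a lam with hA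
  set B := 1 - xM₂ a lam with hB
  have hA₀ : 0 < A := by linarith
  have hB₀ : 0 < B := by linarith
  have hT : 0 < q ^ 3 - 1 := by nlinarith [mul_pos (sub_pos.2 hq) (sub_pos.2 hq)]
  have hS : 0 < 1 - r ^ 3 := by nlinarith [mul_pos hp₀ hp₀]
  -- For exit signs of period three, `t` is `q² + q + 1` with signs inserted: the geometric series
  -- summed over one period.
  have bU : ∀ t : ℝ, |t| ≤ q ^ 2 + q + 1 → |A * t / (q ^ 3 - 1)| ≤ A / (q - 1) := by
    intro t ht
    have : A / (q - 1) = A * (q ^ 2 + q + 1) / (q ^ 3 - 1) := by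
      rw [div_eq_div_iff (by linarith) hT.ne']
      ring
    rw [this, abs_div, abs_mul, abs_of_pos hA₀, abs_of_pos hT]
    gcongr
  have bS : ∀ t : ℝ, |t| ≤ r ^ 2 + r + 1 → |B * t / (1 - r ^ 3)| ≤ B / (1 - r) := by
    intro t ht
    have : B / (1 - r) = B * (r ^ 2 + r + 1) / (1 - r ^ 3) := by
      rw [div_eq_div_iff (by linarith) hS.ne']
      ring
    rw [this, abs_div, abs_mul, abs_of_pos hB₀, abs_of_pos hS]
    gcongr
  -- The signs of `c0`, `c1`, `c2` are the coming exits `+-+`, `-++`, `++-`; those of `d0`, `d1`,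
  -- `d2` come from the past exits.
  have c0 : |q ^ 2 - q + 1| ≤ q ^ 2 + q + 1 := by rw [abs_le]; constructor <;> nlinarith
  have c1 : |-q ^ 2 + q + 1| ≤ q ^ 2 + q + 1 := by rw [abs_le]; constructor <;> nlinarith
  have c2 : |q ^ 2 + q - 1| ≤ q ^ 2 + q + 1 := by rw [abs_le]; constructor <;> nlinarith
  have d0 : |-(r ^ 2 - r + 1)| ≤ r ^ 2 + r + 1 := by rw [abs_le]; constructor <;> nlinarith
  have d1 : |-(-r ^ 2 + r + 1)| ≤ r ^ 2 + r + 1 := by rw [abs_le]; constructor <;> nlinarith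
  have d2 : |-(r ^ 2 + r - 1)| ≤ r ^ 2 + r + 1 := by rw [abs_le]; constructor <;> nlinarith
  have hT' := hT.ne'
  have hS' := hS.ne'
  have j0 := (hN 0 1 _ _ _ (B * -(-r ^ 2 + r + 1) / (1 - r ^ 3)) (by simp) (bU _ c0) (bU _ c1)
    (bS _ d0) (by push_cast; field_simp; ring) (by push_cast; field_simp; ring)).2
  have j1 := (hN (0 + 1) (-1) _ _ _ (B * -(r ^ 2 + r - 1) / (1 - r ^ 3)) (by simp) (bU _ c1)
    (bU _ c2) (bS _ d1) (by push_cast; field_simp; ring) (by push_cast; field_simp; ring)).2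
  have j2 := (hN (0 + 1 + -1) 1 _ _ _ (B * -(r ^ 2 - r + 1) / (1 - r ^ 3)) (by simp) (bU _ c2)
    (bU _ c0) (bS _ d2) (by push_cast; field_simp; ring) (by push_cast; field_simp; ring)).2
  have hin : cylProj (eigenPt a lam (2 * ((0 + 1 + -1 : ℤ) : ℝ) - 1)
      (A * (q ^ 2 + q - 1) / (q ^ 3 - 1)) (B * -(r ^ 2 + r - 1) / (1 - r ^ 3))) ∈ cylP a lam := by
    refine eigenPt_mem_cylP_of_nonneg h _ ?_ ?_ ?_ ?_
    · exact div_nonneg (mul_nonneg hA₀.le (by nlinarith)) hT.le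
    · rw [div_le_iff₀ hT]
      exact mul_le_mul_of_nonneg_left (by nlinarith [mul_nonneg (sub_nonneg.2 hq2) (sq_nonneg q)]) hA₀.le
    · exact div_nonneg (mul_nonneg hB₀.le (by nlinarith)) hS.le
    · rw [div_le_iff₀ hS]
      exact mul_le_mul_of_nonneg_left (by nlinarith) hB₀.le
  have hout : cylProj (eigenPt a lam (2 * ((0 : ℤ) : ℝ) - 1)
      (A * (q ^ 2 - q + 1) / (q ^ 3 - 1)) (B * -(r ^ 2 - r + 1) / (1 - r ^ 3))) ∉ cylP a lam := by
    refine eigenPt_notMem_cylP h _ ?_ ?_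
    · exact div_pos (mul_pos hA₀ (by nlinarith)) hT
    · exact div_neg_of_neg_of_pos (mul_neg_of_pos_of_neg hB₀ (by nlinarith)) hS
  set p := eigenPt a lam (2 * ((0 : ℤ) : ℝ) - 1)
      (A * (q ^ 2 - q + 1) / (q ^ 3 - 1)) (B * -(r ^ 2 - r + 1) / (1 - r ^ 3)) with hpdef
  have h2 : (planeMap a lam)^[(N + 1) + (N + 1)] p = eigenPt a lam (2 * ((0 + 1 + -1 : ℤ) : ℝ) - 1)
      (A * (q ^ 2 + q - 1) / (q ^ 3 - 1)) (B * -(r ^ 2 + r - 1) / (1 - r ^ 3)) := by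
    rw [Function.iterate_add_apply, j0, j1]
  have hper : (planeMap a lam)^[(N + 1) + ((N + 1) + (N + 1))] p = p + (2, 0) := by
    rw [Function.iterate_add_apply, h2, j2, hpdef]
    refine Prod.ext ?_ ?_
    · simp only [eigenPt, Prod.fst_add]
      push_cast
      ring
    · simp [eigenPt]
  have hpos : 0 < (N + 1) + ((N + 1) + (N + 1)) := by omega
  have hcyc := cylMap_iterate_eq_self hper
  have hR := mem_annulusR_of_periodic h hpos hcyc
  have hin' : (cylMap a lam)^[(N + 1) + (N + 1)] (cylProj p) ∈ cylP a lam := by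
    rw [← cylProj_planeMap_iterate, h2]
    exact hin
  have hout' : (cylMap a lam)^[0] (cylProj p) ∈ annulusR a lam \ cylP a lam := ⟨hR 0, hout⟩
  refine ⟨p, ?_, tendsto_abs_liftX hpos hper, frequently_atTop_of_periodic hpos hcyc hin',
    frequently_atTop_of_periodic hpos hcyc hout'⟩
  rw [rotatingOscillatingPart_eq h.lam_pos.ne']
  refine ⟨hR, ⟨((N + 1) + (N + 1) : ℕ), ?_⟩, 0, hout'⟩
  rw [zpow_natCast, ← Equiv.Perm.iterate_eq_pow]
  exact hin'

end Examples

theorem theorem6 (a lam : ℝ) (hlam₀ : 0 < lam) (hlam₁ : lam < 1) (ha : 1 - lam < a) :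
    -- the map has a singular hyperbolic attractor in the annulus `R`
    IsSingularHyperbolicAttractor (cylMap a lam) discontinuityLine (annulusR a lam)
      (attractorOf (cylMap a lam) (annulusR a lam)) ∧
    -- it consists of three disjoint invariant components
    attractorOf (cylMap a lam) (annulusR a lam) =
      oscillatingPart a lam ∪ rotatingPart a lam ∪ rotatingOscillatingPart a lam ∧
    Disjoint (oscillatingPart a lam) (rotatingPart a lam) ∧
    Disjoint (oscillatingPart a lam) (rotatingOscillatingPart a lam) ∧
    Disjoint (rotatingPart a lam) (rotatingOscillatingPart a lam) ∧
    cylMap a lam '' oscillatingPart a lam = oscillatingPart a lam ∧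
    cylMap a lam '' rotatingPart a lam = rotatingPart a lam ∧
    cylMap a lam '' rotatingOscillatingPart a lam = rotatingOscillatingPart a lam ∧
    -- their location
    cylP a lam ⊆ annulusR a lam ∧
    oscillatingPart a lam ⊆ cylP a lam ∧
    rotatingPart a lam ⊆ annulusR a lam \ cylP a lam ∧
    rotatingOscillatingPart a lam ⊆ annulusR a lam ∧
    -- orbits of `A_o` never wind around the cylinder
    (∀ p, cylProj p ∈ oscillatingPart a lam → ∀ n, |liftX a lam p n - p.1| ≤ 2) ∧
    -- and some of them oscillate forever across the line `x = 0`
    (∃ p, cylProj p ∈ oscillatingPart a lam ∧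
      (∃ᶠ n in atTop, liftX a lam p n < 0) ∧ (∃ᶠ n in atTop, 0 < liftX a lam p n)) ∧
    -- `A_r` contains orbits that wind around the cylinder forever
    (∃ p, cylProj p ∈ rotatingPart a lam ∧ Tendsto (fun n => |liftX a lam p n|) atTop atTop) ∧
    -- `A_ro` contains orbits that wind forever and return to `P` and leave it forever
    (∃ p, cylProj p ∈ rotatingOscillatingPart a lam ∧
      Tendsto (fun n => |liftX a lam p n|) atTop atTop ∧
      (∃ᶠ n in atTop, (cylMap a lam)^[n] (cylProj p) ∈ cylP a lam) ∧
      (∃ᶠ n in atTop, (cylMap a lam)^[n] (cylProj p) ∈ annulusR a lam \ cylP a lam)) := by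
  have h : Params a lam := ⟨hlam₀, hlam₁, ha⟩
  have hl := hlam₀.ne'
  refine ⟨isSingularHyperbolicAttractor_cylMap h, attractorOf_eq_union h,
    disjoint_oscillating_rotating h, disjoint_oscillating_rotatingOscillating h,
    disjoint_rotating_rotatingOscillating h, image_oscillatingPart hl, image_rotatingPart hl,
    image_rotatingOscillatingPart hl, cylP_subset_annulusR h, ?_, ?_, ?_,
    fun p hp => abs_liftX_sub_le h hp, exists_oscillating h, exists_rotating h,
    exists_rotatingOscillating h⟩
  · rintro z ⟨o, -, rfl, ho⟩
    exact ho 0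
  · rintro z ⟨o, -, rfl, ho⟩
    exact ho 0
  · rintro z ⟨o, -, rfl, ho, -⟩
    exact ho 0
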